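/- Let $p\in\,]1,2]$, $\sigma\ge 0$, $\varepsilon>0$, $\lambda>0$, $L>0$ and $R\in\mathbb{R}$. Then there is a constant $c\ge 0$, depending only on $p,\sigma,\varepsilon,\lambda,L,R$, such that the following holds. Let $\mathsf H$ be a real separable Hilbert space, $f\colon\mathsf H\to\mathbb R$ convex and $L$-Lipschitz, $\mathsf X\subset\mathsf H$ closed and convex, and let $x_*\in\mathsf X$ satisfy $f(x_*)=f_*:=\min_{\mathsf X}f$. Let $\xi$ be a random variable on a probability space $(\Omega,\mathbb P)$ and let $\hat u(x,s)\in\mathsf H$ be jointly measurable in $x\in\mathsf X$ and $s$, such that for every $x\in\mathsf X$: $\mathbb E\|\hat u(x,\xi)\|<+\infty$, $\mathbb E[\hat u(x,\xi)]\in\partial f(x)=\{u\in\mathsf H: f(y)\ge f(x)+\langle u,y-x\rangle\ \forall y\in\mathsf H\}$, and $\mathbb E\big[\|\hat u(x,\xi)-\mathbb E[\hat u(x,\xi)]\|^p\big]\le\sigma^p$. Let $m\ge 1$ be a batch size, let $(\xi^k_j)_{k\ge 1,\,1\le j\le m}$ be independent copies of $\xi$ on $\Omega$, and let $x_1\in\mathsf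 X$ be deterministic with $\|x_1-x_*\|\le R$. Given stepsizes $\gamma_k$ and clipping levels $\lambda_k$, the clipped stochastic subgradient method is $$\bar u_k=\frac1m\sum_{j=1}^m\hat u(x_k,\xi^k_j),\qquad \tilde u_k=\max\{\|\bar u_k\|/\lambda_k,1\}^{-1}\,\bar u_k,\qquad x_{k+1}=P_{\mathsf X}(x_k-\gamma_k\tilde u_k),$$ where $P_{\mathsf X}$ is the orthogonal projection onto $\mathsf X$; set $\bar x_k=\frac1k\sum_{i=1}^k x_i$. Let $\delta\in\,]0,2/e]$ and $\gamma=1/\log(2/\delta)$. Then for every integer $k\ge1$ the following hold. (i) (Anytime.) If $\gamma_i=\dfrac{\gamma}{(i(1+\log i))^{1/p}}$ and $\lambda_i=\max\{(1+\varepsilon)L,\lambda(i(1+\log i))^{1/p}\}$ for all $i\ge 1$, then with probability at least $1-\delta$ $$f(\bar x_k)-f_*\le c\,\frac{(1+\log k)^{1/p}}{k^{(p-1)/p}}\Big((1+\log(1+\log k))^2+\log(2/\delta)\Big).$$ (ii) (Finite horizon.) If $\gamma_i=\dfrac{\gamma}{k^{1/p}}$ and $\lambda_i=\max\{(1+\varepsilon)L,\lambda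 k^{1/p}\}$ for $1\le i\le k$, then with probability at least $1-\delta$ $$f(\bar x_k)-f_*\le c\,\frac{1}{k^{(p-1)/p}}\Big(1+\log(2/\delta)\Big).$$ -/

import Mathlib

open MeasureTheory ProbabilityTheory
open scoped NNReal

noncomputable section

namespace ClippedSsGM

section Hilbert

variable {H : Type*} [NormedAddCommGroup H] [InnerProductSpace ℝ H]

/-- The subdifferential of `f` at `x`. -/
def subdifferential (f : H → ℝ) (x : H) : Set H :=
  {u | ∀ y, f x + inner ℝ u (y - x) ≤ f y}

/-- The metric projection onto `X`: a point of `X` at minimal distance from `x`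
(and `x` itself if there is none). -/
def proj (X : Set H) (x : H) : H :=
  open Classical in
  if h : ∃ y ∈ X, ∀ z ∈ X, ‖x - y‖ ≤ ‖x - z‖ then h.choose else x

/-- On a nonempty closed convex set the projection exists. -/
theorem proj_spec [CompleteSpace H] {X : Set H} (hne : X.Nonempty) (hc : IsClosed X)
    (hconv : Convex ℝ X) (x : H) :
    proj X x ∈ X ∧ ∀ z ∈ X, ‖x - proj X x‖ ≤ ‖x - z‖ := by
  have h : ∃ y ∈ X, ∀ z ∈ X, ‖x - y‖ ≤ ‖x - z‖ := by
    obtain ⟨y, hy, hmin⟩ := exists_norm_eq_iInf_of_complete_convex hne hc.isComplete hconv x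
    refine ⟨y, hy, fun z hz => ?_⟩
    rw [hmin]
    exact ciInf_le ⟨0, by rintro _ ⟨w, rfl⟩; exact norm_nonneg _⟩ (⟨z, hz⟩ : X)
  unfold proj
  rw [dif_pos h]
  exact h.choose_spec

/-- On a convex set the projection is the only point at minimal distance. -/
theorem proj_unique {X : Set H} (hconv : Convex ℝ X) {x y : H} (hy : y ∈ X)
    (hmin : ∀ z ∈ X, ‖x - y‖ ≤ ‖x - z‖) : proj X x = y := by
  have key : ∀ a ∈ X, (∀ z ∈ X, ‖x - a‖ ≤ ‖x - z‖) → ∀ w ∈ X, inner ℝ (x - a) (w - a) ≤ 0 := by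
    intro a ha hm
    refine (norm_eq_iInf_iff_real_inner_le_zero hconv ha).1 (le_antisymm ?_ ?_)
    · have : Nonempty X := ⟨⟨a, ha⟩⟩
      exact le_ciInf fun z => hm z z.2
    · exact ciInf_le ⟨0, by rintro _ ⟨w, rfl⟩; exact norm_nonneg _⟩ (⟨a, ha⟩ : X)
  have h : ∃ y ∈ X, ∀ z ∈ X, ‖x - y‖ ≤ ‖x - z‖ := ⟨y, hy, hmin⟩
  have hp : proj X x ∈ X ∧ ∀ z ∈ X, ‖x - proj X x‖ ≤ ‖x - z‖ := by
    unfold proj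
    rw [dif_pos h]
    exact h.choose_spec
  have h1 := key _ hp.1 hp.2 y hy
  have h2 := key y hy hmin _ hp.1
  have h3 : inner ℝ (proj X x - y) (proj X x - y) ≤ 0 := by
    have e : inner ℝ (proj X x - y) (proj X x - y)
        = inner ℝ (x - proj X x) (y - proj X x) + inner ℝ (x - y) (proj X x - y) := by
      have e1 : y - proj X x = -(proj X x - y) := by abel
      rw [e1, inner_neg_right, neg_add_eq_sub, ← inner_sub_left]
      congr 1
      abel
    linarith
  exact sub_eq_zero.1 (real_inner_self_nonpos.1 h3)

/-- The clipping operator `CLIP(u, r) = max{‖u‖ / r, 1}⁻¹ u`. -/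
def clip (u : H) (r : ℝ) : H := (max (‖u‖ / r) 1)⁻¹ • u

variable {Ω Ξ : Type*}

/-- The iterates of the clipped stochastic subgradient method with stepsizes `γ 1, γ 2, …`,
clipping levels `Λ 1, Λ 2, …`, batch size `m` and initial point `x₁`.  The iterate `x_{n+1}` is
`iterate … n`; the batch drawn at the `(n+1)`-st iteration is `ξs n`. -/
def iterate (X : Set H) (uhat : H → Ξ → H) (γ Λ : ℕ → ℝ) (m : ℕ) (ξs : ℕ → Fin m → Ω → Ξ)
    (x₁ : H) : ℕ → Ω → H
  | 0, _ => x₁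
  | n + 1, ω =>
    let x := iterate X uhat γ Λ m ξs x₁ n ω
    let ubar := (1 / (m : ℝ)) • ∑ j, uhat x (ξs n j ω)
    proj X (x - γ (n + 1) • clip ubar (Λ (n + 1)))

/-- The average `x̄_k = (x_1 + ⋯ + x_k) / k` of the first `k` iterates. -/
def average (X : Set H) (uhat : H → Ξ → H) (γ Λ : ℕ → ℝ) (m : ℕ) (ξs : ℕ → Fin m → Ω → Ξ)
    (x₁ : H) (k : ℕ) (ω : Ω) : H :=
  (1 / (k : ℝ)) • ∑ n ∈ Finset.range k, iterate X uhat γ Λ m ξs x₁ n ω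

/-- `uhat(·, ξ)` is an unbiased stochastic subgradient of `f` on `X` whose noise has its `p`-th
moment bounded by `σ ^ p`, uniformly over `X`. -/
structure IsStochasticSubgradient [MeasurableSpace H] [MeasurableSpace Ω] [MeasurableSpace Ξ]
    (P : Measure Ω) (f : H → ℝ) (X : Set H) (uhat : H → Ξ → H) (ξ : Ω → Ξ) (p σ : ℝ) :
    Prop where
  measurable_oracle : Measurable fun z : X × Ξ => uhat z.1 z.2
  measurable_variable : Measurable ξ
  integrable : ∀ x ∈ X, Integrable (fun ω => uhat x (ξ ω)) P
  mean_mem : ∀ x ∈ X, ∫ ω, uhat x (ξ ω) ∂P ∈ subdifferential f x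
  moment_integrable : ∀ x ∈ X,
    Integrable (fun ω => ‖uhat x (ξ ω) - ∫ ω', uhat x (ξ ω') ∂P‖ ^ p) P
  moment_le : ∀ x ∈ X, ∫ ω, ‖uhat x (ξ ω) - ∫ ω', uhat x (ξ ω') ∂P‖ ^ p ∂P ≤ σ ^ p

end Hilbert

/-- All the entries of all the batches are independent copies of `ξ`. -/
structure IsSampling {Ω Ξ : Type*} [MeasurableSpace Ω] [MeasurableSpace Ξ] (P : Measure Ω)
    (ξ : Ω → Ξ) (m : ℕ) (ξs : ℕ → Fin m → Ω → Ξ) : Prop where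
  measurable : ∀ n j, Measurable (ξs n j)
  identDistrib : ∀ n j, IdentDistrib (ξs n j) ξ P P
  indep : iIndepFun (fun (q : ℕ × Fin m) => ξs q.1 q.2) P

/-- Anytime stepsizes `γ_k = γ / (k (1 + log k))^{1/p}`. -/
def stepAT (p γ : ℝ) (k : ℕ) : ℝ := γ / ((k : ℝ) * (1 + Real.log k)) ^ (1 / p)

/-- Anytime clipping levels `λ_k = max{(1 + ε) L, λ (k (1 + log k))^{1/p}}`. -/
def clipAT (p L ε lam : ℝ) (k : ℕ) : ℝ :=
  max ((1 + ε) * L) (lam * ((k : ℝ) * (1 + Real.log k)) ^ (1 / p))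

/-- Finite-horizon stepsizes, with horizon `k`: constantly `γ / k^{1/p}`. -/
def stepFH (p γ : ℝ) (k : ℕ) (_i : ℕ) : ℝ := γ / (k : ℝ) ^ (1 / p)

/-- Finite-horizon clipping levels, with horizon `k`: constantly `max{(1 + ε) L, λ k^{1/p}}`. -/
def clipFH (p L ε lam : ℝ) (k : ℕ) (_i : ℕ) : ℝ := max ((1 + ε) * L) (lam * (k : ℝ) ^ (1 / p))

end ClippedSsGM

end

/-!
Divide the step at time `n` by the scale `a n` that enters the stepsize `γ / a n` and the clipping
level `Λ n ≈ λ a n`. Nonexpansiveness of the projection bounds the increase of `‖x n - x⋆‖ ^ 2` by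
`2 γ` times a normalised error made of the inner product of the clipping error with `x n - x⋆` and
a quadratic term. Clipping bounds the normalised gradients, so as long as `‖x n - x⋆‖ ≤ D` the
exponential moment of the error, at a temperature of order `1 / (D + 1)`, exceeds one by at most a
multiple of `a n ^ (-p)`; the bias of the clipping is absorbed because the levels stay above
`(1 + ε) L`.

Stopping the errors when the iterates leave the ball of radius `D` yields an exponential
supermartingale, and hence a tail bound for their sum. On the complementary event the energy
inequality prevents the iterates from ever leaving the ball, so the stopping is void and the sum of
the gaps `f (x n) - f x⋆`, each divided by `a n`, is bounded. As `a` is increasing this controls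
the average gap, and a subgradient at the average of the iterates transfers the bound to it.
-/

namespace ClippedSsGM

section Projection

variable {H : Type*} [NormedAddCommGroup H] [InnerProductSpace ℝ H] [CompleteSpace H] {X : Set H}

theorem inner_sub_proj_nonpos (hc : IsClosed X) (hconv : Convex ℝ X) (x : H) {w : H}
    (hw : w ∈ X) : inner ℝ (x - proj X x) (w - proj X x) ≤ 0 := by
  obtain ⟨hmem, hmin⟩ := proj_spec ⟨w, hw⟩ hc hconv x
  have : Nonempty X := ⟨⟨w, hw⟩⟩
  have hbdd : BddBelow (Set.range fun z : X => ‖x - z‖) :=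
    ⟨0, Set.forall_mem_range.2 fun _ => norm_nonneg _⟩
  exact (norm_eq_iInf_iff_real_inner_le_zero hconv hmem).1
    (le_antisymm (le_ciInf fun z => hmin z z.2) (ciInf_le hbdd ⟨_, hmem⟩)) w hw

theorem lipschitzWith_proj (hne : X.Nonempty) (hc : IsClosed X) (hconv : Convex ℝ X) :
    LipschitzWith 1 (proj X) := by
  refine LipschitzWith.mk_one fun x y => ?_
  rw [dist_eq_norm, dist_eq_norm]
  have hx := inner_sub_proj_nonpos hc hconv x (proj_spec hne hc hconv y).1
  have hy := inner_sub_proj_nonpos hc hconv y (proj_spec hne hc hconv x).1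
  have hsq : ‖proj X x - proj X y‖ ^ 2 ≤ inner ℝ (x - y) (proj X x - proj X y) := by
    rw [← real_inner_self_eq_norm_sq]
    simp only [inner_sub_left, inner_sub_right] at hx hy ⊢
    linarith
  have hcs := hsq.trans (real_inner_le_norm (x - y) (proj X x - proj X y))
  by_contra! hlt
  nlinarith [norm_nonneg (x - y)]

theorem norm_proj_sub_le (hc : IsClosed X) (hconv : Convex ℝ X) (x : H) {w : H} (hw : w ∈ X) :
    ‖proj X x - w‖ ≤ ‖x - w‖ := by
  have h := (lipschitzWith_proj ⟨w, hw⟩ hc hconv).dist_le_mul x w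
  rwa [proj_unique hconv hw (x := w) (by simp), NNReal.coe_one, one_mul, dist_eq_norm,
    dist_eq_norm] at h

end Projection

section Clipping

variable {H : Type*} [NormedAddCommGroup H] [InnerProductSpace ℝ H] {u v : H} {r : ℝ}

theorem continuous_clip (r : ℝ) : Continuous fun u : H => clip u r := by
  unfold clip
  exact ((by fun_prop : Continuous fun u : H => max (‖u‖ / r) 1).inv₀
    fun _ => (one_pos.trans_le (le_max_right _ _)).ne').smul continuous_id

theorem clip_of_le (hr : 0 < r) (h : ‖u‖ ≤ r) : clip u r = u := by
  rw [clip, max_eq_right ((div_le_one hr).2 h), inv_one, one_smul]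

theorem clip_of_ge (hr : 0 < r) (h : r ≤ ‖u‖) : clip u r = (r / ‖u‖) • u := by
  rw [clip, max_eq_left ((one_le_div hr).2 h), inv_div]

theorem clip_smul {c : ℝ} (hc : 0 < c) (u : H) (r : ℝ) : clip (c • u) (c * r) = c • clip u r := by
  rw [clip, clip, norm_smul, Real.norm_of_nonneg hc.le, mul_div_mul_left _ _ hc.ne', smul_comm]

theorem norm_clip_le_norm (u : H) (r : ℝ) : ‖clip u r‖ ≤ ‖u‖ := by
  have h1 : 1 ≤ max (‖u‖ / r) 1 := le_max_right _ _
  rw [clip, norm_smul, norm_inv, Real.norm_of_nonneg (by linarith)]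
  exact mul_le_of_le_one_left (norm_nonneg _) (inv_le_one_of_one_le₀ h1)

theorem norm_clip_le (u : H) (hr : 0 < r) : ‖clip u r‖ ≤ r := by
  rcases le_total ‖u‖ r with h | h
  · exact (norm_clip_le_norm u r).trans h
  · have hu := hr.trans_le h
    rw [clip_of_ge hr h, norm_smul, Real.norm_of_nonneg (by positivity), div_mul_cancel₀ _ hu.ne']

theorem norm_sub_clip (hr : 0 < r) (h : r ≤ ‖u‖) : ‖u - clip u r‖ = ‖u‖ - r := by
  have hu := hr.trans_le h
  have hsmul : u - clip u r = (1 - r / ‖u‖) • u := by rw [clip_of_ge hr h, sub_smul, one_smul]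
  rw [hsmul, norm_smul, Real.norm_of_nonneg (sub_nonneg.2 ((div_le_one hu).2 h))]
  field_simp

theorem norm_sub_clip_le_rpow {p ε : ℝ} (hp : 1 ≤ p) (hε : 0 < ε) (hr : 0 < r)
    (hu : (1 + ε) * ‖u‖ ≤ r) :
    ‖v - clip v r‖ ≤ (ε / (1 + ε) * r) ^ (1 - p) * ‖v - u‖ ^ p := by
  rcases le_total ‖v‖ r with h | h
  · rw [clip_of_le hr h, sub_self, norm_zero]
    positivity
  have htri : ‖v‖ - ‖u‖ ≤ ‖v - u‖ := norm_sub_norm_le v u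
  have hmargin : ε / (1 + ε) * r ≤ r - ‖u‖ := by
    have : ‖u‖ ≤ r / (1 + ε) := by rwa [le_div_iff₀' (by positivity)]
    have : ε / (1 + ε) * r = r - r / (1 + ε) := by field_simp; ring
    linarith
  have hpos : 0 < ε / (1 + ε) * r := by positivity
  have hnoise : 0 < ‖v - u‖ := by linarith
  calc ‖v - clip v r‖ = ‖v‖ - r := norm_sub_clip hr h
    _ ≤ ‖v - u‖ := by linarith [norm_nonneg u, norm_nonneg v]
    _ = ‖v - u‖ ^ (1 - p) * ‖v - u‖ ^ p := by rw [← Real.rpow_add hnoise]; simp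
    _ ≤ (ε / (1 + ε) * r) ^ (1 - p) * ‖v - u‖ ^ p := by
      gcongr ?_ * _
      exact Real.rpow_le_rpow_of_nonpos hpos (by linarith) (by linarith)

theorem sq_le_rpow_mul_rpow {p t r : ℝ} (hp : p ≤ 2) (ht : 0 ≤ t) (h : t ≤ r) :
    t ^ 2 ≤ r ^ (2 - p) * t ^ p := by
  rcases ht.eq_or_lt with rfl | ht
  · rw [zero_pow two_ne_zero]
    positivity
  · calc t ^ 2 = t ^ (2 - p) * t ^ p := by rw [← Real.rpow_add ht]; norm_num
      _ ≤ r ^ (2 - p) * t ^ p := by gcongr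

theorem add_rpow_le_two_mul {p x y : ℝ} (hp : 1 ≤ p) (hp₂ : p ≤ 2) (hx : 0 ≤ x) (hy : 0 ≤ y) :
    (x + y) ^ p ≤ 2 * (x ^ p + y ^ p) := by
  lift x to ℝ≥0 using hx
  lift y to ℝ≥0 using hy
  have h2 : (2 : ℝ≥0) ^ (p - 1) ≤ 2 := by
    simpa using NNReal.rpow_le_rpow_of_exponent_le (x := 2) one_le_two (by linarith : p - 1 ≤ 1)
  exact_mod_cast (NNReal.rpow_add_le_mul_rpow_add_rpow x y hp).trans
    (mul_le_mul_of_nonneg_right h2 zero_le)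

theorem sq_norm_clip_le_rpow {p : ℝ} (hp : 1 ≤ p) (hp₂ : p ≤ 2) (hr : 0 < r) (u v : H) :
    ‖clip v r‖ ^ 2 ≤ 2 * r ^ (2 - p) * (‖u‖ ^ p + ‖v - u‖ ^ p) := by
  have htri : ‖clip v r‖ ≤ ‖u‖ + ‖v - u‖ :=
    (norm_clip_le_norm v r).trans (norm_le_norm_add_norm_sub' v u)
  calc ‖clip v r‖ ^ 2 ≤ r ^ (2 - p) * ‖clip v r‖ ^ p :=
        sq_le_rpow_mul_rpow hp₂ (norm_nonneg _) (norm_clip_le v hr)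
    _ ≤ r ^ (2 - p) * (2 * (‖u‖ ^ p + ‖v - u‖ ^ p)) := by
        gcongr
        exact (Real.rpow_le_rpow (norm_nonneg _) htri (by linarith)).trans
          (add_rpow_le_two_mul hp hp₂ (norm_nonneg _) (norm_nonneg _))
    _ = 2 * r ^ (2 - p) * (‖u‖ ^ p + ‖v - u‖ ^ p) := by ring

end Clipping

section StepError

variable {H : Type*} [NormedAddCommGroup H] [InnerProductSpace ℝ H]

theorem norm_le_of_mem_subdifferential {f : H → ℝ} {L : ℝ≥0} (hf : LipschitzWith L f) {x u : H}
    (hu : u ∈ subdifferential f x) : ‖u‖ ≤ L := by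
  have hsub := hu (x + u)
  have hlip := (le_abs_self _).trans (hf.dist_le_mul (x + u) x)
  rw [dist_eq_norm, add_sub_cancel_left] at hlip
  rw [add_sub_cancel_left, real_inner_self_eq_norm_sq] at hsub
  by_contra! hlt
  nlinarith [L.coe_nonneg]

/-- The error made by the clipped estimate `clip v r` of a subgradient `u`, in a step of length `γ`
taken at displacement `η` from the minimiser: the first-order error plus the squared length of the
step, as they enter the energy inequality `sq_norm_proj_step_le`. -/
noncomputable def stepError (γ r : ℝ) (u v η : H) : ℝ :=
  inner ℝ (u - clip v r) η + γ / 2 * ‖clip v r‖ ^ 2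

theorem sq_norm_proj_step_le [CompleteSpace H] {X : Set H} (hc : IsClosed X) (hconv : Convex ℝ X)
    {f : H → ℝ} {x xs u : H} (hxs : xs ∈ X) (hu : u ∈ subdifferential f x) {γ a : ℝ}
    (hγ : 0 ≤ γ) (ha : 0 < a) (v : H) (Λ : ℝ) :
    ‖proj X (x - (γ / a) • clip v Λ) - xs‖ ^ 2 + 2 * (γ / a) * (f x - f xs)
      ≤ ‖x - xs‖ ^ 2 + 2 * γ * stepError γ (Λ / a) (a⁻¹ • u) (a⁻¹ • v) (x - xs) := by
  set w := clip (a⁻¹ • v) (Λ / a) with hw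
  have hclip : (γ / a) • clip v Λ = γ • w := by
    rw [hw, div_eq_inv_mul Λ, clip_smul (inv_pos.2 ha), smul_smul, div_eq_mul_inv]
  have hproj : ‖proj X (x - γ • w) - xs‖ ^ 2 ≤ ‖(x - xs) - γ • w‖ ^ 2 := by
    rw [sub_right_comm]
    gcongr
    exact norm_proj_sub_le hc hconv _ hxs
  have hsub : γ / a * (f x - f xs) ≤ γ / a * inner ℝ u (x - xs) := by
    have h := hu xs
    rw [← neg_sub x xs, inner_neg_right] at h
    gcongr
    linarith
  rw [norm_sub_sq_real (x - xs), real_inner_smul_right, real_inner_comm, norm_smul, mul_pow,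
    Real.norm_eq_abs, sq_abs] at hproj
  rw [hclip, stepError, ← hw, inner_sub_left, real_inner_smul_left]
  rw [div_eq_mul_inv] at hsub ⊢
  linarith

theorem abs_mul_inner_add_sq_le {γ τ M D : ℝ} {u w η : H} (hγ : 0 ≤ γ) (hγ₁ : γ ≤ 1)
    (hτ : 0 ≤ τ) (hτ₁ : τ * ((1 + M) ^ 2 * (D + 1)) ≤ 1) (hu : ‖u‖ ≤ M) (hw : ‖w‖ ≤ M)
    (hη : ‖η‖ ≤ D) :
    |τ * (inner ℝ (u - w) η + γ / 2 * ‖w‖ ^ 2)| ≤ min 1 (‖u‖ + ‖w‖) := by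
  have hu₀ := norm_nonneg u
  have hw₀ := norm_nonneg w
  have hM : 0 ≤ M := hu₀.trans hu
  have hD : 0 ≤ D := (norm_nonneg η).trans hη
  set s := τ * (D + 1) with hs
  have hs₀ : 0 ≤ s := by positivity
  have : s * (1 + M) ^ 2 ≤ 1 := by rw [hs]; linarith
  have hs₂ : s * (1 + M) ≤ 1 := by nlinarith [mul_nonneg hs₀ hM]
  have habs : |τ * (inner ℝ (u - w) η + γ / 2 * ‖w‖ ^ 2)| ≤ s * (‖u‖ + (1 + M) * ‖w‖) := by
    have hinner : |inner ℝ (u - w) η| ≤ (‖u‖ + ‖w‖) * D :=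
      (abs_real_inner_le_norm _ _).trans (by gcongr; exact norm_sub_le u w)
    have hsq : γ / 2 * ‖w‖ ^ 2 ≤ M * ‖w‖ := by nlinarith [sq_nonneg ‖w‖]
    rw [abs_mul, abs_of_nonneg hτ, hs, mul_assoc]
    gcongr
    refine (abs_add_le _ _).trans ?_
    rw [abs_of_nonneg (by positivity : 0 ≤ γ / 2 * ‖w‖ ^ 2)]
    nlinarith [mul_nonneg (mul_nonneg hM hD) hw₀]
  refine habs.trans (le_min ?_ ?_)
  · calc s * (‖u‖ + (1 + M) * ‖w‖) ≤ s * (M + (1 + M) * M) := by gcongr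
      _ ≤ 1 := by linarith
  · nlinarith [mul_nonneg hs₀ hM]

theorem exp_mul_inner_add_sq_le {γ τ M D : ℝ} {u w η : H} (v : H) (hγ : 0 ≤ γ) (hγ₁ : γ ≤ 1)
    (hτ : 0 ≤ τ) (hτ₁ : τ * ((1 + M) ^ 2 * (D + 1)) ≤ 1) (hu : ‖u‖ ≤ M) (hw : ‖w‖ ≤ M)
    (hη : ‖η‖ ≤ D) :
    Real.exp (τ * (inner ℝ (u - w) η + γ / 2 * ‖w‖ ^ 2))
      ≤ 1 + τ * inner ℝ (u - v) η + ‖v - w‖ + 2 * ‖u‖ ^ 2 + 3 * ‖w‖ ^ 2 := by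
  have hM : 0 ≤ M := (norm_nonneg u).trans hu
  have hD : 0 ≤ D := (norm_nonneg η).trans hη
  have habs := abs_mul_inner_add_sq_le hγ hγ₁ hτ hτ₁ hu hw hη
  set y := τ * (inner ℝ (u - w) η + γ / 2 * ‖w‖ ^ 2) with hy
  have hexp : Real.exp y ≤ 1 + y + y ^ 2 := by
    linarith [(abs_le.1 (Real.abs_exp_sub_one_sub_id_le (habs.trans (min_le_left _ _)))).2]
  have hsq : y ^ 2 ≤ 2 * ‖u‖ ^ 2 + 2 * ‖w‖ ^ 2 := by
    have := sq_le_sq.2 ((habs.trans (min_le_right _ _)).trans (le_abs_self _))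
    linarith [add_sq_le (a := ‖u‖) (b := ‖w‖)]
  have hlin : y ≤ τ * inner ℝ (u - v) η + ‖v - w‖ + ‖w‖ ^ 2 := by
    have hτD : τ * (D + 1) ≤ 1 := by
      nlinarith [mul_nonneg (mul_nonneg hτ (by linarith : 0 ≤ D + 1)) hM,
        mul_nonneg (mul_nonneg (mul_nonneg hτ (by linarith : 0 ≤ D + 1)) hM) hM]
    have hbias : τ * inner ℝ (v - w) η ≤ ‖v - w‖ := by
      calc τ * inner ℝ (v - w) η ≤ τ * (‖v - w‖ * D) := by
            gcongr
            exact (real_inner_le_norm _ _).trans (by gcongr)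
        _ ≤ ‖v - w‖ := by nlinarith [norm_nonneg (v - w)]
    have hlength : τ * (γ / 2 * ‖w‖ ^ 2) ≤ ‖w‖ ^ 2 := by
      have : τ * γ ≤ 1 := mul_le_one₀ (by nlinarith) hγ hγ₁
      nlinarith [sq_nonneg ‖w‖]
    rw [hy, ← sub_add_sub_cancel u v w, inner_add_left]
    linarith
  linarith

/-- The constant in the bound on the exponential moment of the error of a clipped step, when the
clipping level relative to the step lies between `lam` and `M`. -/
noncomputable def momentConst (p ε lam M : ℝ) : ℝ :=
  (ε / (1 + ε) * lam) ^ (1 - p) + 8 * M ^ (2 - p)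

theorem momentConst_nonneg {p ε lam M : ℝ} (hε : 0 ≤ ε) (hlam : 0 ≤ lam) (hM : 0 ≤ M) :
    0 ≤ momentConst p ε lam M := by
  unfold momentConst
  positivity

/-- The linear term is split at the unclipped estimate `v`, since `u - v` has mean zero. -/
theorem exp_mul_stepError_le {p ε lam M γ τ r D : ℝ} {u η : H} (hp : 1 ≤ p) (hp₂ : p ≤ 2)
    (hε : 0 < ε) (hlam : 0 < lam) (hlr : lam ≤ r) (hrM : r ≤ M) (hur : (1 + ε) * ‖u‖ ≤ r)
    (hγ : 0 ≤ γ) (hγ₁ : γ ≤ 1) (hτ : 0 ≤ τ) (hτ₁ : τ * ((1 + M) ^ 2 * (D + 1)) ≤ 1)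
    (hη : ‖η‖ ≤ D) (v : H) :
    Real.exp (τ * stepError γ r u v η)
      ≤ 1 + τ * inner ℝ (u - v) η + momentConst p ε lam M * (‖u‖ ^ p + ‖v - u‖ ^ p) := by
  have hr : 0 < r := hlam.trans_le hlr
  have huM : ‖u‖ ≤ M := by nlinarith [norm_nonneg u]
  have hexp := exp_mul_inner_add_sq_le v hγ hγ₁ hτ hτ₁ huM ((norm_clip_le v hr).trans hrM) hη
  have hu₀ : 0 ≤ ‖u‖ ^ p := by positivity
  have hn₀ : 0 ≤ ‖v - u‖ ^ p := by positivity
  have hbias : ‖v - clip v r‖ ≤ (ε / (1 + ε) * lam) ^ (1 - p) * ‖v - u‖ ^ p := by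
    refine (norm_sub_clip_le_rpow hp hε hr hur).trans ?_
    gcongr ?_ * _
    exact Real.rpow_le_rpow_of_nonpos (by positivity) (by gcongr) (by linarith)
  have hmean : ‖u‖ ^ 2 ≤ M ^ (2 - p) * ‖u‖ ^ p := sq_le_rpow_mul_rpow hp₂ (norm_nonneg u) huM
  have hclip : ‖clip v r‖ ^ 2 ≤ 2 * M ^ (2 - p) * (‖u‖ ^ p + ‖v - u‖ ^ p) :=
    (sq_norm_clip_le_rpow hp hp₂ hr u v).trans (by gcongr)
  have hM₀ : 0 ≤ M ^ (2 - p) := Real.rpow_nonneg (hr.le.trans hrM) _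
  have hlam₀ : 0 ≤ (ε / (1 + ε) * lam) ^ (1 - p) := by positivity
  rw [stepError, momentConst]
  nlinarith [mul_nonneg hM₀ hn₀, mul_nonneg hlam₀ hu₀]

end StepError

section BatchMean

variable {H Ξ : Type*} [NormedAddCommGroup H] [NormedSpace ℝ H] {m : ℕ}

/-- The average of the stochastic subgradients at `x` over a batch. -/
noncomputable def batchMean (uhat : H → Ξ → H) (x : H) (b : Fin m → Ξ) : H :=
  (1 / (m : ℝ)) • ∑ j, uhat x (b j)

theorem rpow_norm_batchMean_sub_le {uhat : H → Ξ → H} {x : H} {p : ℝ} (hp : 1 ≤ p)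
    (hm : 1 ≤ m) (b : Fin m → Ξ) (u : H) :
    ‖batchMean uhat x b - u‖ ^ p ≤ ∑ j, 1 / (m : ℝ) * ‖uhat x (b j) - u‖ ^ p := by
  have hm₀ : (m : ℝ) ≠ 0 := by positivity
  have hcentre : batchMean uhat x b - u = ∑ j, (1 / (m : ℝ)) • (uhat x (b j) - u) := by
    simp only [batchMean, smul_sub, Finset.sum_sub_distrib, ← Finset.smul_sum, Finset.sum_const,
      Finset.card_univ, Fintype.card_fin]
    rw [← Nat.cast_smul_eq_nsmul ℝ m u, smul_smul, one_div_mul_cancel hm₀, one_smul]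
  have hnorm : ‖batchMean uhat x b - u‖ ≤ ∑ j, 1 / (m : ℝ) * ‖uhat x (b j) - u‖ := by
    rw [hcentre]
    refine (norm_sum_le _ _).trans (Finset.sum_le_sum fun j _ => ?_)
    rw [norm_smul, Real.norm_of_nonneg (by positivity)]
  exact (Real.rpow_le_rpow (norm_nonneg _) hnorm (by linarith)).trans
    (Real.rpow_arith_mean_le_arith_mean_rpow _ _ _ (fun _ _ => by positivity)
      (by simp [hm₀]) (fun _ _ => norm_nonneg _) hp)

end BatchMean

section Oracle

variable {H : Type*} [NormedAddCommGroup H] [InnerProductSpace ℝ H] [MeasurableSpace H]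
  {Ω Ξ : Type*} [MeasurableSpace Ω] [MeasurableSpace Ξ] {P : Measure Ω}
  {f : H → ℝ} {X : Set H} {uhat : H → Ξ → H} {ξ : Ω → Ξ} {p σ : ℝ} {x : H}

theorem IsStochasticSubgradient.measurable_apply
    (h : IsStochasticSubgradient P f X uhat ξ p σ) (hx : x ∈ X) : Measurable (uhat x) :=
  h.measurable_oracle.comp ((measurable_const (a := (⟨x, hx⟩ : X))).prodMk measurable_id)

section Batch

variable [BorelSpace H] {m : ℕ} {b : Fin m → Ω → Ξ}

theorem IsStochasticSubgradient.integrable_of_identDistrib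
    (h : IsStochasticSubgradient P f X uhat ξ p σ) (hx : x ∈ X) {ξ' : Ω → Ξ}
    (hξ' : IdentDistrib ξ' ξ P P) : Integrable (fun ω => uhat x (ξ' ω)) P :=
  (hξ'.comp (h.measurable_apply hx)).integrable_iff.2 (h.integrable x hx)

theorem IsStochasticSubgradient.integrable_batchMean
    (h : IsStochasticSubgradient P f X uhat ξ p σ) (hx : x ∈ X)
    (hb : ∀ j, IdentDistrib (b j) ξ P P) :
    Integrable (fun ω => batchMean uhat x fun j => b j ω) P :=
  (integrable_finsetSum _ fun j _ => h.integrable_of_identDistrib hx (hb j)).smul (1 / (m : ℝ))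

theorem IsStochasticSubgradient.integral_batchMean
    (h : IsStochasticSubgradient P f X uhat ξ p σ) (hx : x ∈ X)
    (hb : ∀ j, IdentDistrib (b j) ξ P P) (hm : 1 ≤ m) :
    ∫ ω, batchMean uhat x (fun j => b j ω) ∂P = ∫ ω, uhat x (ξ ω) ∂P := by
  have hmean : ∀ j, ∫ ω, uhat x (b j ω) ∂P = ∫ ω, uhat x (ξ ω) ∂P := fun j =>
    ((hb j).comp (h.measurable_apply hx)).integral_eq
  unfold batchMean
  rw [integral_smul, integral_finsetSum _ fun j _ => h.integrable_of_identDistrib hx (hb j)]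
  simp only [hmean, Finset.sum_const, Finset.card_univ, Fintype.card_fin]
  rw [← Nat.cast_smul_eq_nsmul ℝ, smul_smul, one_div_mul_cancel (by positivity), one_smul]

theorem IsStochasticSubgradient.moment_batchMean
    (h : IsStochasticSubgradient P f X uhat ξ p σ) (hx : x ∈ X)
    (hb : ∀ j, IdentDistrib (b j) ξ P P) (hp : 1 ≤ p) (hm : 1 ≤ m) :
    Integrable (fun ω => ‖batchMean uhat x (fun j => b j ω) - ∫ ω', uhat x (ξ ω') ∂P‖ ^ p) P ∧
      ∫ ω, ‖batchMean uhat x (fun j => b j ω) - ∫ ω', uhat x (ξ ω') ∂P‖ ^ p ∂P ≤ σ ^ p := by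
  have hm₀ : (m : ℝ) ≠ 0 := by positivity
  set u := ∫ ω', uhat x (ξ ω') ∂P
  have hid : ∀ j, IdentDistrib (fun ω => ‖uhat x (b j ω) - u‖ ^ p)
      (fun ω => ‖uhat x (ξ ω) - u‖ ^ p) P P := fun j =>
    (hb j).comp (u := fun s => ‖uhat x s - u‖ ^ p)
      (((h.measurable_apply hx).sub_const u).norm.pow_const p)
  have hint : ∀ j, Integrable (fun ω => 1 / (m : ℝ) * ‖uhat x (b j ω) - u‖ ^ p) P := fun j =>
    ((hid j).integrable_iff.2 (h.moment_integrable x hx)).const_mul _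
  have hsum : Integrable (fun ω => ∑ j, 1 / (m : ℝ) * ‖uhat x (b j ω) - u‖ ^ p) P :=
    integrable_finsetSum _ fun j _ => hint j
  have hle : ∀ ω, ‖batchMean uhat x (fun j => b j ω) - u‖ ^ p
      ≤ ∑ j, 1 / (m : ℝ) * ‖uhat x (b j ω) - u‖ ^ p := fun ω =>
    rpow_norm_batchMean_sub_le hp hm _ u
  have hbatch : Integrable (fun ω => ‖batchMean uhat x (fun j => b j ω) - u‖ ^ p) P := by
    refine hsum.mono' (AEMeasurable.aestronglyMeasurable ?_) (ae_of_all _ fun ω => ?_)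
    · exact (((h.integrable_batchMean hx hb).aestronglyMeasurable.aemeasurable.sub_const
        u).norm).pow_const p
    · rw [Real.norm_of_nonneg (by positivity)]
      exact hle ω
  refine ⟨hbatch, (integral_mono hbatch hsum hle).trans ?_⟩
  rw [integral_finsetSum _ fun j _ => hint j]
  simp only [integral_const_mul, fun j => (hid j).integral_eq, Finset.sum_const, Finset.card_univ,
    Fintype.card_fin, nsmul_eq_mul]
  rw [← mul_assoc, mul_one_div_cancel hm₀, one_mul]
  exact h.moment_le x hx

theorem IsStochasticSubgradient.measurable_batchMean [SecondCountableTopology H]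
    (h : IsStochasticSubgradient P f X uhat ξ p σ) :
    Measurable fun z : X × (Fin m → Ξ) => batchMean uhat (z.1 : H) z.2 :=
  (Finset.measurable_sum _ fun j _ => h.measurable_oracle.comp
    (measurable_fst.prodMk ((measurable_pi_apply j).comp measurable_snd))).const_smul (1 / (m : ℝ))

theorem isStochasticSubgradient_batchMean [SecondCountableTopology H]
    (h : IsStochasticSubgradient P f X uhat ξ p σ) (hb : ∀ j, IdentDistrib (b j) ξ P P)
    (hbm : ∀ j, Measurable (b j)) (hp : 1 ≤ p) (hm : 1 ≤ m) :
    IsStochasticSubgradient P f X (batchMean uhat) (fun ω j => b j ω) p σ where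
  measurable_oracle := h.measurable_batchMean
  measurable_variable := measurable_pi_lambda _ hbm
  integrable _ hx := h.integrable_batchMean hx hb
  mean_mem x hx := h.integral_batchMean hx hb hm ▸ h.mean_mem x hx
  moment_integrable _ hx := h.integral_batchMean hx hb hm ▸ (h.moment_batchMean hx hb hp hm).1
  moment_le _ hx := h.integral_batchMean hx hb hm ▸ (h.moment_batchMean hx hb hp hm).2

end Batch

theorem rpow_norm_inv_smul {E : Type*} [NormedAddCommGroup E] [NormedSpace ℝ E] {a : ℝ}
    (ha : 0 ≤ a) (p : ℝ) (w : E) : ‖a⁻¹ • w‖ ^ p = a ^ (-p) * ‖w‖ ^ p := by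
  rw [norm_smul, norm_inv, Real.norm_of_nonneg ha, Real.mul_rpow (by positivity) (norm_nonneg _),
    Real.inv_rpow ha, Real.rpow_neg ha]

theorem lintegral_exp_le_of_exp_le_one_add {Z Y : Ω → ℝ} {c : ℝ} [IsProbabilityMeasure P]
    (hle : ∀ ω, Real.exp (Z ω) ≤ 1 + Y ω) (hY : Integrable Y P) (hc : ∫ ω, Y ω ∂P ≤ c) :
    ∫⁻ ω, ENNReal.ofReal (Real.exp (Z ω)) ∂P ≤ ENNReal.ofReal (Real.exp c) := by
  have hint : Integrable (fun ω => 1 + Y ω) P := (integrable_const 1).add hY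
  calc ∫⁻ ω, ENNReal.ofReal (Real.exp (Z ω)) ∂P
      ≤ ∫⁻ ω, ENNReal.ofReal (1 + Y ω) ∂P :=
        lintegral_mono fun ω => ENNReal.ofReal_le_ofReal (hle ω)
    _ = ENNReal.ofReal (∫ ω, (1 + Y ω) ∂P) :=
        (ofReal_integral_eq_lintegral_ofReal hint
          (ae_of_all _ fun ω => (Real.exp_nonneg _).trans (hle ω))).symm
    _ ≤ ENNReal.ofReal (Real.exp c) := by
        refine ENNReal.ofReal_le_ofReal ?_
        rw [integral_add (integrable_const 1) hY, integral_const, probReal_univ, one_smul]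
        linarith [Real.add_one_le_exp c]

theorem IsStochasticSubgradient.integral_inner_mean_sub [CompleteSpace H] [IsProbabilityMeasure P]
    (h : IsStochasticSubgradient P f X uhat ξ p σ) (hx : x ∈ X) (η : H) :
    ∫ ω, inner ℝ (∫ ω', uhat x (ξ ω') ∂P - uhat x (ξ ω)) η ∂P = 0 := by
  have hint := (integrable_const (∫ ω', uhat x (ξ ω') ∂P)).sub (h.integrable x hx)
  simp only [real_inner_comm η]
  rw [integral_inner (f := fun ω => ∫ ω', uhat x (ξ ω') ∂P - uhat x (ξ ω)) hint,
    integral_sub (integrable_const _) (h.integrable x hx)]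
  simp

theorem IsStochasticSubgradient.lintegral_exp_stepError_le [CompleteSpace H]
    [IsProbabilityMeasure P] (h : IsStochasticSubgradient P f X uhat ξ p σ) (hx : x ∈ X)
    {ε lam M γ τ a Λ D : ℝ} {L : ℝ≥0} {η : H} (hf : LipschitzWith L f) (hp : 1 ≤ p) (hp₂ : p ≤ 2)
    (hε : 0 < ε) (hlam : 0 < lam) (ha : 0 < a) (hΛL : (1 + ε) * L ≤ Λ) (hΛlam : lam * a ≤ Λ)
    (hΛM : Λ ≤ M * a) (hγ : 0 ≤ γ) (hγ₁ : γ ≤ 1) (hτ : 0 ≤ τ)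
    (hτ₁ : τ * ((1 + M) ^ 2 * (D + 1)) ≤ 1) (hη : ‖η‖ ≤ D) :
    ∫⁻ ω, ENNReal.ofReal (Real.exp (τ * stepError γ (Λ / a) (a⁻¹ • ∫ ω', uhat x (ξ ω') ∂P)
        (a⁻¹ • uhat x (ξ ω)) η)) ∂P
      ≤ ENNReal.ofReal (Real.exp (momentConst p ε lam M * (L ^ p + σ ^ p) * a ^ (-p))) := by
  set u := ∫ ω', uhat x (ξ ω') ∂P
  set K := momentConst p ε lam M
  have hM : 0 < M := pos_of_mul_pos_left ((mul_pos hlam ha).trans_le (hΛlam.trans hΛM)) ha.le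
  have hK : 0 ≤ K := momentConst_nonneg hε.le hlam.le hM.le
  have huL : ‖u‖ ≤ L := norm_le_of_mem_subdifferential hf (h.mean_mem x hx)
  have hlevel : (1 + ε) * ‖a⁻¹ • u‖ ≤ Λ / a := by
    rw [norm_smul, norm_inv, Real.norm_of_nonneg ha.le, le_div_iff₀ ha]
    calc (1 + ε) * (a⁻¹ * ‖u‖) * a = (1 + ε) * ‖u‖ := by field_simp
      _ ≤ Λ := (by gcongr : (1 + ε) * ‖u‖ ≤ (1 + ε) * L).trans hΛL
  have hlinear : Integrable (fun ω => inner ℝ (u - uhat x (ξ ω)) η) P :=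
    ((integrable_const u).sub (h.integrable x hx)).inner_const η
  have hmoment : Integrable (fun ω => ‖u‖ ^ p + ‖uhat x (ξ ω) - u‖ ^ p) P :=
    (integrable_const _).add (h.moment_integrable x hx)
  have hmoment_le : ∫ ω, (‖u‖ ^ p + ‖uhat x (ξ ω) - u‖ ^ p) ∂P ≤ L ^ p + σ ^ p := by
    rw [integral_add (integrable_const _) (h.moment_integrable x hx), integral_const,
      probReal_univ, one_smul]
    gcongr
    exact h.moment_le x hx
  refine lintegral_exp_le_of_exp_le_one_add
    (Y := fun ω => τ * a⁻¹ * inner ℝ (u - uhat x (ξ ω)) η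
      + K * a ^ (-p) * (‖u‖ ^ p + ‖uhat x (ξ ω) - u‖ ^ p)) (fun ω => ?_)
    ((hlinear.const_mul _).add (hmoment.const_mul _)) ?_
  · have hexp := exp_mul_stepError_le hp hp₂ hε hlam ((le_div_iff₀ ha).2 hΛlam)
      ((div_le_iff₀ ha).2 hΛM) hlevel hγ hγ₁ hτ hτ₁ hη (a⁻¹ • uhat x (ξ ω))
    rw [← smul_sub, ← smul_sub, real_inner_smul_left, rpow_norm_inv_smul ha.le,
      rpow_norm_inv_smul ha.le] at hexp
    linarith
  · rw [integral_add (hlinear.const_mul _) (hmoment.const_mul _), integral_const_mul,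
      integral_const_mul, h.integral_inner_mean_sub hx, mul_zero, zero_add, mul_right_comm]
    gcongr

end Oracle

section Confinement

variable {e g z : ℕ → ℝ} {E B : ℝ} {k : ℕ}

theorem add_sum_le_add_sum (hstep : ∀ n, e (n + 1) + g n ≤ e n + z n) (k : ℕ) :
    e k + ∑ n ∈ Finset.range k, g n ≤ e 0 + ∑ n ∈ Finset.range k, z n := by
  induction k with
  | zero => simp
  | succ k ih =>
    rw [Finset.sum_range_succ, Finset.sum_range_succ]
    linarith [hstep k]

theorem le_of_stopped_sum_le (hstep : ∀ n, e (n + 1) ≤ e n + z n)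
    (hsum : ∑ n ∈ Finset.range k, (if ∀ j ≤ n, e j ≤ E then z n else 0) ≤ B)
    (hB : e 0 + B ≤ E) : ∀ n ≤ k, e n ≤ E := by
  intro n
  induction n using Nat.strong_induction_on with
  | _ n ih =>
    intro hn
    by_contra! hexit
    have hstopped : ∑ i ∈ Finset.range k, (if ∀ j ≤ i, e j ≤ E then z i else 0)
        = ∑ i ∈ Finset.range n, z i := by
      rw [← Finset.sum_subset (Finset.range_mono hn)]
      · refine Finset.sum_congr rfl fun i hi => if_pos fun j hj => ?_
        have := Finset.mem_range.1 hi
        exact ih j (by omega) (by omega)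
      · exact fun i _ hi => if_neg fun h => hexit.not_ge (h n (by simpa using hi))
    have := add_sum_le_add_sum (g := 0) (by simpa using hstep) n
    simp only [Pi.zero_apply, Finset.sum_const_zero] at this
    linarith

theorem sum_le_of_stopped_sum_le (he : ∀ n, 0 ≤ e n) (hg : ∀ n, 0 ≤ g n)
    (hstep : ∀ n, e (n + 1) + g n ≤ e n + z n)
    (hsum : ∑ n ∈ Finset.range k, (if ∀ j ≤ n, e j ≤ E then z n else 0) ≤ B)
    (hB : e 0 + B ≤ E) : ∑ n ∈ Finset.range k, g n ≤ E := by
  have hconf := le_of_stopped_sum_le (fun n => by linarith [hstep n, hg n]) hsum hB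
  have hz : ∑ n ∈ Finset.range k, (if ∀ j ≤ n, e j ≤ E then z n else 0)
      = ∑ n ∈ Finset.range k, z n :=
    Finset.sum_congr rfl fun n hn =>
      if_pos fun j hj => hconf j (hj.trans (Finset.mem_range.1 hn).le)
  linarith [add_sum_le_add_sum hstep k, he k]

end Confinement

section Concentration

open scoped ENNReal

variable {Ω T : Type*} [MeasurableSpace T]

theorem lintegral_comp_prodMk_of_indepFun {mΩ : MeasurableSpace Ω} {P : Measure Ω}
    [IsProbabilityMeasure P] {S : Type*} [MeasurableSpace S] {x : Ω → S} {b : Ω → T}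
    (hx : Measurable x) (hb : Measurable b) (hind : IndepFun x b P) {g : S × T → ℝ≥0∞}
    (hg : Measurable g) :
    ∫⁻ ω, g (x ω, b ω) ∂P = ∫⁻ ω, ∫⁻ ω', g (x ω, b ω') ∂P ∂P := by
  have : IsProbabilityMeasure (P.map b) := Measure.isProbabilityMeasure_map hb.aemeasurable
  calc ∫⁻ ω, g (x ω, b ω) ∂P = ∫⁻ q, g q ∂(P.map fun ω => (x ω, b ω)) :=
        (lintegral_map hg (hx.prodMk hb)).symm
    _ = ∫⁻ ω, ∫⁻ t, g (x ω, t) ∂(P.map b) ∂P := by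
        rw [(indepFun_iff_map_prod_eq_prod_map_map hx.aemeasurable hb.aemeasurable).1 hind,
          lintegral_prod _ hg.aemeasurable, lintegral_map hg.lintegral_prod_right' hx]
    _ = ∫⁻ ω, ∫⁻ ω', g (x ω, b ω') ∂P ∂P :=
        lintegral_congr fun ω => lintegral_map (hg.comp measurable_prodMk_left) hb

theorem lintegral_comp_prodMk_of_indep {𝓖 mΩ : MeasurableSpace Ω} {P : Measure Ω}
    [IsProbabilityMeasure P] (h𝓖 : 𝓖 ≤ mΩ) {b : Ω → T} (hb : Measurable b)
    (hind : Indep 𝓖 (MeasurableSpace.comap b inferInstance) P) {g : Ω × T → ℝ≥0∞}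
    (hg : Measurable[𝓖.prod inferInstance] g) :
    ∫⁻ ω, g (ω, b ω) ∂P = ∫⁻ ω, ∫⁻ ω', g (ω, b ω') ∂P ∂P := by
  have hindFun : @IndepFun Ω Ω T mΩ 𝓖 _ id b P :=
    (@IndepFun_iff_Indep _ _ _ mΩ 𝓖 _ id b P).2 (by rwa [MeasurableSpace.comap_id])
  exact @lintegral_comp_prodMk_of_indepFun Ω T _ mΩ P _ Ω 𝓖 id b (measurable_id'' h𝓖) hb hindFun
    g hg

variable {mΩ : MeasurableSpace Ω} {P : Measure Ω} [IsProbabilityMeasure P] {𝓕 : Filtration ℕ mΩ}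
  {b : ℕ → Ω → T} {ζ : ℕ → Ω × T → ℝ} {c : ℕ → ℝ}

theorem measurable_sum_comp_prodMk (hb : ∀ n, Measurable[𝓕 (n + 1)] (b n))
    (hζ : ∀ n, Measurable[(𝓕 n).prod inferInstance] (ζ n)) (k : ℕ) :
    Measurable[𝓕 k] fun ω => ∑ n ∈ Finset.range k, ζ n (ω, b n ω) :=
  Finset.measurable_sum _ fun n hn => (hζ n).comp
    ((measurable_id'' (𝓕.mono (Finset.mem_range.1 hn).le)).prodMk
      ((hb n).mono (𝓕.mono (Finset.mem_range.1 hn)) le_rfl))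

theorem measurable_ite_forall_mem {S : Type*} [MeasurableSpace S] {x : ℕ → Ω → S}
    (hx : ∀ n, Measurable[𝓕 n] (x n)) {g : S × T → ℝ} (hg : Measurable g) {G : Set S}
    (hG : MeasurableSet G) [∀ n ω, Decidable (∀ j ≤ n, x j ω ∈ G)] (n : ℕ) :
    Measurable[(𝓕 n).prod inferInstance] fun z : Ω × T =>
      if ∀ j ≤ n, x j z.1 ∈ G then g (x n z.1, z.2) else 0 := by
  have hfst : Measurable[(𝓕 n).prod inferInstance, 𝓕 n] (Prod.fst : Ω × T → Ω) :=
    @measurable_fst _ _ (𝓕 n) _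
  have hstay : MeasurableSet[𝓕 n] {ω | ∀ j ≤ n, x j ω ∈ G} := by
    simp only [Set.ofPred_forall]
    exact MeasurableSet.iInter fun j => MeasurableSet.iInter fun hj => 𝓕.mono hj _ (hx j hG)
  exact Measurable.ite (hfst hstay) (hg.comp (((hx n).comp hfst).prodMk measurable_snd))
    measurable_const

theorem lintegral_exp_sum_le (hb : ∀ n, Measurable[𝓕 (n + 1)] (b n))
    (hind : ∀ n, Indep (𝓕 n) (MeasurableSpace.comap (b n) inferInstance) P)
    (hζ : ∀ n, Measurable[(𝓕 n).prod inferInstance] (ζ n))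
    (hexp : ∀ n ω, ∫⁻ ω', ENNReal.ofReal (Real.exp (ζ n (ω, b n ω'))) ∂P
      ≤ ENNReal.ofReal (Real.exp (c n))) (k : ℕ) :
    ∫⁻ ω, ENNReal.ofReal (Real.exp (∑ n ∈ Finset.range k, ζ n (ω, b n ω))) ∂P
      ≤ ENNReal.ofReal (Real.exp (∑ n ∈ Finset.range k, c n)) := by
  induction k with
  | zero => simp
  | succ k ih =>
    set W : Ω → ℝ≥0∞ := fun ω =>
      ENNReal.ofReal (Real.exp (∑ n ∈ Finset.range k, ζ n (ω, b n ω))) with hWdef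
    have hW : Measurable[𝓕 k] W :=
      (Real.measurable_exp.comp (measurable_sum_comp_prodMk hb hζ k)).ennreal_ofReal
    have hb' := (hb k).mono (𝓕.le (k + 1)) le_rfl
    have hsection (ω : Ω) :
        Measurable fun ω' => ENNReal.ofReal (Real.exp (ζ k (ω, b k ω'))) :=
      (((hζ k).comp (@measurable_prodMk_left _ _ (𝓕 k) _ ω)).comp hb').exp.ennreal_ofReal
    have hg : Measurable[(𝓕 k).prod inferInstance] fun q : Ω × T =>
        W q.1 * ENNReal.ofReal (Real.exp (ζ k q)) :=
      (hW.comp (@measurable_fst _ _ (𝓕 k) _)).mul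
        (Real.measurable_exp.comp (hζ k)).ennreal_ofReal
    calc ∫⁻ ω, ENNReal.ofReal (Real.exp (∑ n ∈ Finset.range (k + 1), ζ n (ω, b n ω))) ∂P
        = ∫⁻ ω, W ω * ENNReal.ofReal (Real.exp (ζ k (ω, b k ω))) ∂P := by
          simp only [hWdef, Finset.sum_range_succ, Real.exp_add,
            ENNReal.ofReal_mul (Real.exp_nonneg _)]
      _ = ∫⁻ ω, W ω * ∫⁻ ω', ENNReal.ofReal (Real.exp (ζ k (ω, b k ω'))) ∂P ∂P := by
          rw [lintegral_comp_prodMk_of_indep (𝓕.le k) hb' (hind k) hg]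
          exact lintegral_congr fun ω => lintegral_const_mul (W ω) (hsection ω)
      _ ≤ ∫⁻ ω, W ω * ENNReal.ofReal (Real.exp (c k)) ∂P := by
          gcongr with ω
          exact hexp k ω
      _ ≤ ENNReal.ofReal (Real.exp (∑ n ∈ Finset.range k, c n))
          * ENNReal.ofReal (Real.exp (c k)) := by
          rw [lintegral_mul_const _ (hW.mono (𝓕.le k) le_rfl)]
          gcongr
      _ = ENNReal.ofReal (Real.exp (∑ n ∈ Finset.range (k + 1), c n)) := by
          rw [Finset.sum_range_succ, Real.exp_add, ENNReal.ofReal_mul (Real.exp_nonneg _)]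

theorem measure_sum_add_le_sum_le (hb : ∀ n, Measurable[𝓕 (n + 1)] (b n))
    (hind : ∀ n, Indep (𝓕 n) (MeasurableSpace.comap (b n) inferInstance) P)
    (hζ : ∀ n, Measurable[(𝓕 n).prod inferInstance] (ζ n))
    (hexp : ∀ n ω, ∫⁻ ω', ENNReal.ofReal (Real.exp (ζ n (ω, b n ω'))) ∂P
      ≤ ENNReal.ofReal (Real.exp (c n))) (k : ℕ) (t : ℝ) :
    P {ω | ∑ n ∈ Finset.range k, c n + t ≤ ∑ n ∈ Finset.range k, ζ n (ω, b n ω)}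
      ≤ ENNReal.ofReal (Real.exp (-t)) := by
  set C := ∑ n ∈ Finset.range k, c n
  have hmeas := ((measurable_sum_comp_prodMk hb hζ k).mono (𝓕.le k) le_rfl).exp.ennreal_ofReal
  have hne : ENNReal.ofReal (Real.exp (C + t)) ≠ 0 := by simpa using Real.exp_pos _
  calc P {ω | C + t ≤ ∑ n ∈ Finset.range k, ζ n (ω, b n ω)}
      ≤ P {ω | ENNReal.ofReal (Real.exp (C + t))
          ≤ ENNReal.ofReal (Real.exp (∑ n ∈ Finset.range k, ζ n (ω, b n ω)))} :=
        measure_mono fun ω hω => ENNReal.ofReal_le_ofReal (Real.exp_le_exp.2 hω)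
    _ ≤ ENNReal.ofReal (Real.exp C) / ENNReal.ofReal (Real.exp (C + t)) :=
        (meas_ge_le_lintegral_div hmeas.aemeasurable hne ENNReal.ofReal_ne_top).trans
          (ENNReal.div_le_div_right (lintegral_exp_sum_le hb hind hζ hexp k) _)
    _ = ENNReal.ofReal (Real.exp (-t)) := by
        rw [← ENNReal.ofReal_div_of_pos (Real.exp_pos _), ← Real.exp_sub, sub_add_cancel_left]

end Concentration

section SampleFiltration

variable {Ω Ξ : Type*} {mΩ : MeasurableSpace Ω} [MeasurableSpace Ξ] {m : ℕ}
  {ξs : ℕ → Fin m → Ω → Ξ}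

/-- The filtration of the sampling process: the `n`-th σ-algebra is generated by the batches drawn
before the batch `ξs n`, so that the `n`-th iterate is measurable with respect to it and the batch
`ξs n` is independent of it. -/
def sampleFiltration (ξs : ℕ → Fin m → Ω → Ξ) (hξs : ∀ n j, Measurable (ξs n j)) :
    Filtration ℕ mΩ where
  seq n := ⨆ q ∈ {q : ℕ × Fin m | q.1 < n}, MeasurableSpace.comap (ξs q.1 q.2) inferInstance
  mono' _ _ hab := biSup_mono fun _ hq => lt_of_lt_of_le hq hab
  le' _ := iSup₂_le fun q _ => (hξs q.1 q.2).comap_le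

theorem measurable_batch_iSup (ξs : ℕ → Fin m → Ω → Ξ) {n : ℕ} {s : Set (ℕ × Fin m)}
    (hs : ∀ j, (n, j) ∈ s) :
    Measurable[⨆ q ∈ s, MeasurableSpace.comap (ξs q.1 q.2) inferInstance] fun ω j => ξs n j ω :=
  @measurable_pi_lambda _ _ _ (_) _ _ fun j => Measurable.of_comap_le
    (le_biSup (fun q : ℕ × Fin m => MeasurableSpace.comap (ξs q.1 q.2) inferInstance) (hs j))

theorem measurable_batch_sampleFiltration (hξs : ∀ n j, Measurable (ξs n j)) (n : ℕ) :
    Measurable[sampleFiltration ξs hξs (n + 1)] fun ω (j : Fin m) => ξs n j ω :=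
  measurable_batch_iSup ξs fun _ => Nat.lt_succ_self n

theorem IsSampling.indep_sampleFiltration {P : Measure Ω} {ξ : Ω → Ξ} (h : IsSampling P ξ m ξs)
    (n : ℕ) :
    Indep (sampleFiltration ξs h.measurable n)
      (MeasurableSpace.comap (fun ω (j : Fin m) => ξs n j ω) inferInstance) P := by
  have hdisj : Disjoint {q : ℕ × Fin m | q.1 < n} {q : ℕ × Fin m | q.1 = n} :=
    Set.disjoint_left.2 fun _ hlt heq => hlt.ne heq
  have hind := indep_iSup_of_disjoint
    (m := fun q : ℕ × Fin m => MeasurableSpace.comap (ξs q.1 q.2) inferInstance)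
    (fun q => (h.measurable q.1 q.2).comap_le) h.indep.iIndep hdisj
  have hbatch := measurable_batch_iSup ξs (n := n) (s := {q | q.1 = n}) fun _ => rfl
  exact indep_of_indep_of_le_right hind hbatch.comap_le

end SampleFiltration

section StoppedError

variable {H Ω T : Type*} [NormedAddCommGroup H] [InnerProductSpace ℝ H] [MeasurableSpace H]
  {mΩ : MeasurableSpace Ω} [MeasurableSpace T] {P : Measure Ω} {f : H → ℝ} {X : Set H}
  {v : H → T → H} {b : ℕ → Ω → T} {p σ γ : ℝ} {a Λ : ℕ → ℝ} {n : ℕ}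

/-- The error `stepError` committed by the clipped method at its `n`-th step, from the point `y` and
when the oracle `v` receives the sample `t` with the law of `b n`. All the vectors are normalised by
the scale `a n`, which is the inverse of the stepsize up to the factor `γ`. -/
noncomputable def oracleError (P : Measure Ω) (v : H → T → H) (b : ℕ → Ω → T) (γ : ℝ) (a Λ : ℕ → ℝ)
    (xs : H) (n : ℕ) (y : H) (t : T) : ℝ :=
  stepError γ (Λ n / a n) ((a n)⁻¹ • ∫ ω, v y (b n ω) ∂P) ((a n)⁻¹ • v y t) (y - xs)

variable [SecondCountableTopology H] [BorelSpace H] [IsProbabilityMeasure P]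

theorem IsStochasticSubgradient.measurable_integral
    (h : IsStochasticSubgradient P f X v (b n) p σ) :
    Measurable fun y : X => ∫ ω, v y (b n ω) ∂P :=
  (h.measurable_oracle.comp (measurable_fst.prodMk
    (h.measurable_variable.comp measurable_snd))).stronglyMeasurable.integral_prod_right'.measurable

theorem IsStochasticSubgradient.measurable_oracleError
    (h : IsStochasticSubgradient P f X v (b n) p σ) (xs : H) :
    Measurable fun z : X × T => oracleError P v b γ a Λ xs n z.1 z.2 := by
  have hmean : Measurable fun z : X × T => (a n)⁻¹ • ∫ ω, v z.1 (b n ω) ∂P :=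
    (h.measurable_integral.comp measurable_fst).const_smul _
  have hclip : Measurable fun z : X × T => clip ((a n)⁻¹ • v z.1 z.2) (Λ n / a n) :=
    (continuous_clip _).measurable.comp (h.measurable_oracle.const_smul _)
  have hdir : Measurable fun z : X × T => (z.1 : H) - xs :=
    (measurable_subtype_coe.comp measurable_fst).sub_const xs
  exact ((hmean.sub hclip).inner hdir).add ((hclip.norm.pow_const 2).const_mul _)

variable [CompleteSpace H] {𝓕 : Filtration ℕ mΩ} {x : ℕ → Ω → X} {L : ℝ≥0}

theorem measure_sum_stopped_oracleError_ge_le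
    (hv : ∀ n, IsStochasticSubgradient P f X v (b n) p σ)
    (hb : ∀ n, Measurable[𝓕 (n + 1)] (b n))
    (hind : ∀ n, Indep (𝓕 n) (MeasurableSpace.comap (b n) inferInstance) P)
    (hx : ∀ n, Measurable[𝓕 n] (x n)) {ε lam M D : ℝ} (hf : LipschitzWith L f) (hp : 1 ≤ p)
    (hp₂ : p ≤ 2) (hσ : 0 ≤ σ) (hε : 0 < ε) (hlam : 0 < lam) (ha : ∀ n, 0 < a n)
    (hΛL : ∀ n, (1 + ε) * L ≤ Λ n) (hΛlam : ∀ n, lam * a n ≤ Λ n) (hΛM : ∀ n, Λ n ≤ M * a n)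
    (hγ : 0 ≤ γ) (hγ₁ : γ ≤ 1) (hD : 0 ≤ D) (xs : H) (k : ℕ) (t : ℝ) :
    P {ω | (1 + M) ^ 2 * (D + 1)
          * (momentConst p ε lam M * (L ^ p + σ ^ p) * ∑ n ∈ Finset.range k, a n ^ (-p) + t)
        ≤ ∑ n ∈ Finset.range k, if ∀ j ≤ n, ‖(x j ω : H) - xs‖ ^ 2 ≤ D ^ 2
          then oracleError P v b γ a Λ xs n (x n ω) (b n ω) else 0}
      ≤ ENNReal.ofReal (Real.exp (-t)) := by
  have hM : 0 ≤ M :=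
    hlam.le.trans (le_of_mul_le_mul_right ((hΛlam 0).trans (hΛM 0)) (ha 0))
  set s : ℝ := (1 + M) ^ 2 * (D + 1)
  set C := momentConst p ε lam M * (L ^ p + σ ^ p)
  have hs : 0 < s := by positivity
  have hC : 0 ≤ C := mul_nonneg (momentConst_nonneg hε.le hlam.le hM) (by positivity)
  set ζ : ℕ → Ω × T → ℝ := fun n z => if ∀ j ≤ n, ‖(x j z.1 : H) - xs‖ ^ 2 ≤ D ^ 2
    then s⁻¹ * oracleError P v b γ a Λ xs n (x n z.1) z.2 else 0
  have hball : MeasurableSet {y : X | ‖(y : H) - xs‖ ^ 2 ≤ D ^ 2} :=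
    measurableSet_le ((measurable_subtype_coe.sub_const xs).norm.pow_const 2) measurable_const
  have hζ (n) : Measurable[(𝓕 n).prod inferInstance] (ζ n) :=
    measurable_ite_forall_mem hx (((hv n).measurable_oracleError xs).const_mul s⁻¹) hball n
  have hexp (n ω) : ∫⁻ ω', ENNReal.ofReal (Real.exp (ζ n (ω, b n ω'))) ∂P
      ≤ ENNReal.ofReal (Real.exp (C * a n ^ (-p))) := by
    by_cases hstay : ∀ j ≤ n, ‖(x j ω : H) - xs‖ ^ 2 ≤ D ^ 2
    · simp only [ζ, if_pos hstay]
      exact (hv n).lintegral_exp_stepError_le (x n ω).2 hf hp hp₂ hε hlam (ha n) (hΛL n)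
        (hΛlam n) (hΛM n) hγ hγ₁ (by positivity) (inv_mul_cancel₀ hs.ne').le
        (abs_le_of_sq_le_sq' (hstay n le_rfl) hD).2
    · simp only [ζ, if_neg hstay, Real.exp_zero, ENNReal.ofReal_one, lintegral_const,
        measure_univ, mul_one, ENNReal.one_le_ofReal]
      exact Real.one_le_exp (mul_nonneg hC (Real.rpow_nonneg (ha n).le _))
  refine (measure_mono fun ω hω => ?_).trans (measure_sum_add_le_sum_le hb hind hζ hexp k t)
  have hscale : ∑ n ∈ Finset.range k, ζ n (ω, b n ω) = s⁻¹ * ∑ n ∈ Finset.range k,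
      if ∀ j ≤ n, ‖(x j ω : H) - xs‖ ^ 2 ≤ D ^ 2
        then oracleError P v b γ a Λ xs n (x n ω) (b n ω) else 0 := by
    simp only [ζ, Finset.mul_sum, mul_ite, mul_zero]
  rw [Set.mem_ofPred_eq] at hω ⊢
  rwa [hscale, ← Finset.mul_sum, le_inv_mul_iff₀ hs]

end StoppedError

section Averaging

theorem sum_le_mul_of_sum_div_le {g a : ℕ → ℝ} {A S : ℝ} {k : ℕ} (hg : ∀ n, 0 ≤ g n)
    (ha : ∀ n, 0 < a n) (haA : ∀ n < k, a n ≤ A) (hS : ∑ n ∈ Finset.range k, g n / a n ≤ S)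
    (hA : 0 ≤ A) : ∑ n ∈ Finset.range k, g n ≤ A * S :=
  calc ∑ n ∈ Finset.range k, g n = ∑ n ∈ Finset.range k, a n * (g n / a n) :=
        Finset.sum_congr rfl fun n _ => (mul_div_cancel₀ _ (ha n).ne').symm
    _ ≤ ∑ n ∈ Finset.range k, A * (g n / a n) :=
        Finset.sum_le_sum fun n hn => mul_le_mul_of_nonneg_right
          (haA n (Finset.mem_range.1 hn)) (div_nonneg (hg n) (ha n).le)
    _ ≤ A * S := by
        rw [← Finset.mul_sum]
        gcongr

theorem map_average_sub_le_of_mem_subdifferential {H : Type*} [NormedAddCommGroup H]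
    [InnerProductSpace ℝ H] {f : H → ℝ} {x : ℕ → H} {u : H} {k : ℕ} (hk : k ≠ 0)
    (hu : u ∈ subdifferential f ((1 / (k : ℝ)) • ∑ n ∈ Finset.range k, x n)) (c : ℝ) :
    f ((1 / (k : ℝ)) • ∑ n ∈ Finset.range k, x n) - c
      ≤ (∑ n ∈ Finset.range k, (f (x n) - c)) / k := by
  set y := (1 / (k : ℝ)) • ∑ n ∈ Finset.range k, x n with hy
  have hsum : ∑ n ∈ Finset.range k, (f y + inner ℝ u (x n - y)) = k * f y := by
    have hcenter : ∑ n ∈ Finset.range k, (x n - y) = 0 := by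
      rw [Finset.sum_sub_distrib, Finset.sum_const, Finset.card_range, ← Nat.cast_smul_eq_nsmul ℝ,
        hy, smul_smul, mul_one_div_cancel (Nat.cast_ne_zero.2 hk), one_smul, sub_self]
    rw [Finset.sum_add_distrib, ← inner_sum, hcenter, inner_zero_right, add_zero,
      Finset.sum_const, Finset.card_range, nsmul_eq_mul]
  have hle := Finset.sum_le_sum fun n (_ : n ∈ Finset.range k) => hu (x n)
  rw [le_div_iff₀ (by positivity), Finset.sum_sub_distrib, Finset.sum_const, Finset.card_range,
    nsmul_eq_mul]
  linarith

end Averaging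

section Iterates

variable {H : Type*} [NormedAddCommGroup H] [InnerProductSpace ℝ H] [CompleteSpace H]
  {Ω Ξ : Type*} {X : Set H} {uhat : H → Ξ → H} {step Λ : ℕ → ℝ} {m : ℕ}
  {ξs : ℕ → Fin m → Ω → Ξ} {x₁ xs : H}

theorem iterate_mem (hc : IsClosed X) (hconv : Convex ℝ X) (hx₁ : x₁ ∈ X) (n : ℕ) (ω : Ω) :
    iterate X uhat step Λ m ξs x₁ n ω ∈ X := by
  cases n with
  | zero => exact hx₁
  | succ n => exact (proj_spec ⟨x₁, hx₁⟩ hc hconv _).1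

theorem average_mem (hc : IsClosed X) (hconv : Convex ℝ X) (hx₁ : x₁ ∈ X) {k : ℕ} (hk : k ≠ 0)
    (ω : Ω) : average X uhat step Λ m ξs x₁ k ω ∈ X := by
  rw [average, Finset.smul_sum]
  refine hconv.sum_mem (fun _ _ => by positivity) ?_ fun n _ => iterate_mem hc hconv hx₁ n ω
  rw [Finset.sum_const, Finset.card_range, nsmul_eq_mul,
    mul_one_div_cancel (Nat.cast_ne_zero.2 hk)]

variable [MeasurableSpace H] [MeasurableSpace Ω] [MeasurableSpace Ξ] {P : Measure Ω} {f : H → ℝ}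
  {ξ : Ω → Ξ} {p σ : ℝ}

theorem IsStochasticSubgradient.measurable_iterate [SecondCountableTopology H] [BorelSpace H]
    (h : IsStochasticSubgradient P f X uhat ξ p σ) (hξs : ∀ n j, Measurable (ξs n j))
    (hc : IsClosed X) (hconv : Convex ℝ X) (hx₁ : x₁ ∈ X) (n : ℕ) :
    Measurable[sampleFiltration ξs hξs n] fun ω =>
      (⟨iterate X uhat step Λ m ξs x₁ n ω, iterate_mem hc hconv hx₁ n ω⟩ : X) := by
  induction n with
  | zero => exact measurable_const (a := (⟨x₁, hx₁⟩ : X))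
  | succ n ih =>
    have hstep : Measurable fun z : X × (Fin m → Ξ) =>
        (z.1 : H) - step (n + 1) • clip (batchMean uhat (z.1 : H) z.2) (Λ (n + 1)) :=
      (measurable_subtype_coe.comp measurable_fst).sub
        (((continuous_clip _).measurable.comp h.measurable_batchMean).const_smul _)
    have hproj := (lipschitzWith_proj ⟨x₁, hx₁⟩ hc hconv).continuous.measurable.comp hstep
    exact (hproj.comp ((ih.mono ((sampleFiltration ξs hξs).mono n.le_succ) le_rfl).prodMk
      (measurable_batch_sampleFiltration hξs n))).subtype_mk

theorem map_average_sub_le_of_sum_stopped_oracleError_le {γ D B : ℝ} {a : ℕ → ℝ} {k : ℕ} {ω : Ω}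
    (hv : ∀ n, IsStochasticSubgradient P f X (batchMean uhat) (fun ω j => ξs n j ω) p σ)
    (hc : IsClosed X) (hconv : Convex ℝ X) (hx₁ : x₁ ∈ X) (hxs : xs ∈ X) (hmin : IsMinOn f X xs)
    (ha : 0 < a 1) (hmono : MonotoneOn a (Set.Ici 1)) (hγ : 0 < γ) (hk : k ≠ 0)
    (hB : ‖x₁ - xs‖ ^ 2 + 2 * γ * B ≤ D ^ 2)
    (hsum : ∑ n ∈ Finset.range k,
      (if ∀ j ≤ n, ‖iterate X uhat (fun i => γ / a i) Λ m ξs x₁ j ω - xs‖ ^ 2 ≤ D ^ 2 then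
        oracleError P (batchMean uhat) (fun n ω j => ξs n j ω) γ (fun n => a (n + 1))
          (fun n => Λ (n + 1)) xs n (iterate X uhat (fun i => γ / a i) Λ m ξs x₁ n ω)
          (fun j => ξs n j ω)
      else 0) ≤ B) :
    f (average X uhat (fun i => γ / a i) Λ m ξs x₁ k ω) - f xs
      ≤ a k / k * (D ^ 2 / (2 * γ)) := by
  set x : ℕ → H := fun n => iterate X uhat (fun i => γ / a i) Λ m ξs x₁ n ω
  have hxX (n) : x n ∈ X := iterate_mem hc hconv hx₁ n ω
  have hgap (n) : 0 ≤ f (x n) - f xs := sub_nonneg.2 (hmin (hxX n))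
  have hapos (n) : 0 < a (n + 1) := ha.trans_le (hmono (by simp) (by simp) (by simp))
  have ha_le (n) (hn : n < k) : a (n + 1) ≤ a k :=
    hmono (by simp) (Nat.one_le_iff_ne_zero.2 hk) hn
  have henergy : ∑ n ∈ Finset.range k, 2 * (γ / a (n + 1)) * (f (x n) - f xs) ≤ D ^ 2 := by
    refine sum_le_of_stopped_sum_le (e := fun n => ‖x n - xs‖ ^ 2) (fun n => sq_nonneg _)
      (fun n => mul_nonneg (mul_nonneg zero_le_two (div_pos hγ (hapos n)).le) (hgap n))
      (fun n => sq_norm_proj_step_le hc hconv hxs ((hv n).mean_mem _ (hxX n)) hγ.le (hapos n)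
        (batchMean uhat (x n) fun j => ξs n j ω) (Λ (n + 1))) ?_ hB
    have hscaled := mul_le_mul_of_nonneg_left hsum (mul_pos two_pos hγ).le
    simp only [Finset.mul_sum, mul_ite, mul_zero] at hscaled
    exact hscaled
  have hweighted : ∑ n ∈ Finset.range k, (f (x n) - f xs) / a (n + 1) ≤ D ^ 2 / (2 * γ) := by
    rw [le_div_iff₀' (by positivity), Finset.mul_sum]
    exact le_of_eq_of_le (Finset.sum_congr rfl fun n _ => by ring) henergy
  have hregret := sum_le_mul_of_sum_div_le hgap hapos ha_le hweighted
    (ha.le.trans (hmono (by simp) (Nat.one_le_iff_ne_zero.2 hk) (Nat.one_le_iff_ne_zero.2 hk)))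
  calc f (average X uhat (fun i => γ / a i) Λ m ξs x₁ k ω) - f xs
      ≤ (∑ n ∈ Finset.range k, (f (x n) - f xs)) / k :=
        map_average_sub_le_of_mem_subdifferential hk
          ((hv 0).mean_mem _ (average_mem hc hconv hx₁ hk ω)) _
    _ ≤ a k * (D ^ 2 / (2 * γ)) / k := by gcongr
    _ = a k / k * (D ^ 2 / (2 * γ)) := mul_div_right_comm _ _ _

end Iterates

section Rate

theorem one_sub_le_measureReal_of_compl_subset {Ω : Type*} {mΩ : MeasurableSpace Ω}
    {P : Measure Ω} [IsProbabilityMeasure P] {s t : Set Ω} {r : ℝ} (hsub : sᶜ ⊆ t) (hr : 0 ≤ r)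
    (hs : P s ≤ ENNReal.ofReal r) : 1 - r ≤ P.real t := by
  have hcover : (Set.univ : Set Ω) ⊆ s ∪ t := fun ω _ => or_iff_not_imp_left.2 fun hω => hsub hω
  have hadd := (measureReal_mono hcover (measure_ne_top P _)).trans (measureReal_union_le s t)
  have hs_real : P.real s ≤ r := ENNReal.toReal_le_of_le_ofReal hr hs
  rw [probReal_univ] at hadd
  linarith

/-- The constant that, multiplied by `1 + γ ℓ`, gives the radius `D` of the ball in which the
iterates stay, when `ℓ` bounds the sum of `a n ^ (-p)` over the scales `a n`. -/
noncomputable def radiusConst (p σ ε lam R L : ℝ) : ℝ :=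
  R + 1 + 4 * ((1 + ((1 + ε) * L + lam)) ^ 2
    * (momentConst p ε lam ((1 + ε) * L + lam) * (L ^ p + σ ^ p) + 1))

theorem sq_add_two_mul_noise_le_sq_radius {R K C γ ℓ T D : ℝ} (hR : 0 ≤ R) (hK : 0 ≤ K) (hC : 0 ≤ C)
    (hγ : 0 ≤ γ) (hℓ : 0 ≤ ℓ) (hγT : γ * T = 1)
    (hD : D = (R + 1 + 4 * (K * (C + 1))) * (1 + γ * ℓ)) :
    R ^ 2 + 2 * γ * (K * (D + 1) * (C * ℓ + T)) ≤ D ^ 2 := by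
  have hG : 1 ≤ 1 + γ * ℓ := le_add_of_nonneg_right (mul_nonneg hγ hℓ)
  have hRD : R + 1 ≤ D := by
    rw [hD]
    exact (le_add_of_nonneg_right (by positivity)).trans
      (le_mul_of_one_le_right (by positivity) hG)
  have hnoise : γ * (C * ℓ + T) ≤ (C + 1) * (1 + γ * ℓ) := by
    nlinarith [mul_nonneg hγ hℓ]
  have hRDG : R ≤ (1 + γ * ℓ) * D :=
    (by linarith : R ≤ D).trans (le_mul_of_one_le_left (by linarith) hG)
  calc R ^ 2 + 2 * γ * (K * (D + 1) * (C * ℓ + T))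
      = R * R + 2 * (K * (D + 1)) * (γ * (C * ℓ + T)) := by ring
    _ ≤ R * ((1 + γ * ℓ) * D) + 2 * (K * (D + D)) * ((C + 1) * (1 + γ * ℓ)) := by
        have hD₁ : 1 ≤ D := by linarith
        have : 0 ≤ D + 1 := by linarith
        refine add_le_add (by gcongr) ?_
        exact (mul_le_mul_of_nonneg_left hnoise (by positivity)).trans (by gcongr)
    _ ≤ (R + 1 + 4 * (K * (C + 1))) * (1 + γ * ℓ) * D := by
        have : 0 ≤ (1 + γ * ℓ) * D := hR.trans hRDG
        linarith
    _ = D ^ 2 := by rw [← hD, sq]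

theorem sq_radius_div_two_mul_le {r γ ℓ T : ℝ} (hT : 1 ≤ T) (hγT : γ * T = 1) :
    (r * (1 + γ * ℓ)) ^ 2 / (2 * γ) ≤ r ^ 2 * (ℓ ^ 2 + T) := by
  have hγ : 0 < γ := by nlinarith
  have hγ₁ : γ ≤ 1 := by nlinarith
  rw [div_le_iff₀ (by positivity), mul_pow]
  calc r ^ 2 * (1 + γ * ℓ) ^ 2 ≤ r ^ 2 * (2 * (γ * ℓ ^ 2 + γ * T)) := by
        gcongr
        have hγℓ : γ * (γ * ℓ ^ 2) ≤ γ * ℓ ^ 2 := mul_le_of_le_one_left (by positivity) hγ₁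
        nlinarith [sq_nonneg (1 - γ * ℓ)]
    _ = r ^ 2 * (ℓ ^ 2 + T) * (2 * γ) := by ring

variable {H : Type*} [NormedAddCommGroup H] [InnerProductSpace ℝ H] [CompleteSpace H]
  [MeasurableSpace H] [BorelSpace H] [SecondCountableTopology H] {Ω Ξ : Type*} [MeasurableSpace Ω]
  [MeasurableSpace Ξ] {P : Measure Ω} [IsProbabilityMeasure P] {f : H → ℝ} {X : Set H}
  {uhat : H → Ξ → H} {ξ : Ω → Ξ} {m : ℕ} {ξs : ℕ → Fin m → Ω → Ξ} {x₁ xs : H}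

theorem IsStochasticSubgradient.one_sub_exp_le_measureReal_average_of_radius
    {p σ ε lam M γ D t : ℝ} {L : ℝ≥0} {a Λ : ℕ → ℝ} {k : ℕ}
    (h : IsStochasticSubgradient P f X uhat ξ p σ) (hs : IsSampling P ξ m ξs) (hm : 1 ≤ m)
    (hf : LipschitzWith L f) (hc : IsClosed X) (hconv : Convex ℝ X) (hxs : xs ∈ X)
    (hmin : IsMinOn f X xs) (hx₁ : x₁ ∈ X) (hp : 1 ≤ p) (hp₂ : p ≤ 2) (hσ : 0 ≤ σ) (hε : 0 < ε)
    (hlam : 0 < lam) (ha : 0 < a 1) (hmono : MonotoneOn a (Set.Ici 1))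
    (hΛL : ∀ n, (1 + ε) * L ≤ Λ (n + 1)) (hΛlam : ∀ n, lam * a (n + 1) ≤ Λ (n + 1))
    (hΛM : ∀ n, Λ (n + 1) ≤ M * a (n + 1)) (hγ : 0 < γ) (hγ₁ : γ ≤ 1) (hk : k ≠ 0) (hD : 0 ≤ D)
    (hB : ‖x₁ - xs‖ ^ 2 + 2 * γ * ((1 + M) ^ 2 * (D + 1) * (momentConst p ε lam M
      * (L ^ p + σ ^ p) * ∑ n ∈ Finset.range k, a (n + 1) ^ (-p) + t)) ≤ D ^ 2) :
    1 - Real.exp (-t) ≤ P.real {ω | f (average X uhat (fun i => γ / a i) Λ m ξs x₁ k ω) - f xs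
      ≤ a k / k * (D ^ 2 / (2 * γ))} := by
  have hapos (n) : 0 < a (n + 1) := ha.trans_le (hmono (by simp) (by simp) (by simp))
  have hv (n) : IsStochasticSubgradient P f X (batchMean uhat) (fun ω j => ξs n j ω) p σ :=
    isStochasticSubgradient_batchMean h (hs.identDistrib n) (hs.measurable n) hp hm
  have hadapted := h.measurable_iterate (step := fun i => γ / a i) (Λ := Λ) hs.measurable hc hconv
    hx₁
  have htail := measure_sum_stopped_oracleError_ge_le hv
    (measurable_batch_sampleFiltration hs.measurable) hs.indep_sampleFiltration hadapted hf hp hp₂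
    hσ hε hlam hapos hΛL hΛlam hΛM hγ.le hγ₁ hD xs k t
  exact one_sub_le_measureReal_of_compl_subset (fun ω hω =>
    map_average_sub_le_of_sum_stopped_oracleError_le hv hc hconv hx₁ hxs hmin ha hmono hγ hk hB
      (le_of_not_ge hω)) (Real.exp_nonneg _) htail

theorem IsStochasticSubgradient.one_sub_exp_le_measureReal_average {p σ ε lam R ℓ T : ℝ} {L : ℝ≥0}
    {a : ℕ → ℝ} {k : ℕ} (h : IsStochasticSubgradient P f X uhat ξ p σ) (hs : IsSampling P ξ m ξs)
    (hm : 1 ≤ m) (hf : LipschitzWith L f) (hc : IsClosed X) (hconv : Convex ℝ X) (hxs : xs ∈ X)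
    (hmin : IsMinOn f X xs) (hx₁ : x₁ ∈ X) (hR : ‖x₁ - xs‖ ≤ R) (hp : 1 ≤ p) (hp₂ : p ≤ 2)
    (hσ : 0 ≤ σ) (hε : 0 < ε) (hlam : 0 < lam) (ha : 1 ≤ a 1) (hmono : MonotoneOn a (Set.Ici 1))
    (hT : 1 ≤ T) (hk : k ≠ 0) (hℓ : ∑ n ∈ Finset.range k, a (n + 1) ^ (-p) ≤ ℓ) :
    1 - Real.exp (-T) ≤ P.real {ω | f (average X uhat (fun i => 1 / T / a i)
        (fun i => max ((1 + ε) * L) (lam * a i)) m ξs x₁ k ω) - f xs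
      ≤ radiusConst p σ ε lam R L ^ 2 * (a k / k * (ℓ ^ 2 + T))} := by
  have hγ : 0 < 1 / T := by positivity
  have hγT : 1 / T * T = 1 := one_div_mul_cancel (by positivity)
  have ha₁ (n) : 1 ≤ a (n + 1) := ha.trans (hmono (by simp) (by simp) (by simp))
  have hℓ₀ : 0 ≤ ℓ := (Finset.sum_nonneg fun n _ =>
    Real.rpow_nonneg (zero_le_one.trans (ha₁ n)) _).trans hℓ
  have hΛM (n) : max ((1 + ε) * L) (lam * a (n + 1)) ≤ ((1 + ε) * L + lam) * a (n + 1) := by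
    have hlevel : 0 ≤ (1 + ε) * (L : ℝ) := by positivity
    have ha₀ : 0 ≤ a (n + 1) := zero_le_one.trans (ha₁ n)
    rw [add_mul _ lam]
    refine max_le ((le_mul_of_one_le_right hlevel (ha₁ n)).trans ?_) ?_
    · exact le_add_of_nonneg_right (mul_nonneg hlam.le ha₀)
    · exact le_add_of_nonneg_left (mul_nonneg hlevel ha₀)
  have hC : 0 ≤ momentConst p ε lam ((1 + ε) * L + lam) * (L ^ p + σ ^ p) :=
    mul_nonneg (momentConst_nonneg hε.le hlam.le (by positivity)) (by positivity)
  have hR₀ : 0 ≤ R := (norm_nonneg _).trans hR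
  have hradius := sq_add_two_mul_noise_le_sq_radius hR₀ (sq_nonneg (1 + ((1 + ε) * L + lam))) hC
    hγ.le hℓ₀ hγT rfl
  have hD₀ : 0 ≤ radiusConst p σ ε lam R L * (1 + 1 / T * ℓ) := by
    unfold radiusConst
    positivity
  refine (h.one_sub_exp_le_measureReal_average_of_radius (M := (1 + ε) * L + lam)
    (Λ := fun i => max ((1 + ε) * L) (lam * a i)) hs hm hf hc hconv hxs hmin hx₁ hp hp₂ hσ hε hlam
    (zero_lt_one.trans_le ha) hmono (fun n => le_max_left _ _) (fun n => le_max_right _ _) hΛM hγ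
    ((div_le_one (by positivity)).2 hT) hk hD₀ (le_trans ?_ hradius)).trans ?_
  · unfold radiusConst
    gcongr
  · refine measureReal_mono (Set.ofPred_subset_ofPred.2 fun ω hω => hω.trans ?_)
    have hk₁ : 1 ≤ k := Nat.one_le_iff_ne_zero.2 hk
    have hak : 0 ≤ a k := zero_le_one.trans (ha.trans (hmono (Set.mem_Ici.2 le_rfl) hk₁ hk₁))
    rw [mul_left_comm]
    gcongr
    exact sq_radius_div_two_mul_le hT hγT

end Rate

section Scales

theorem sum_inv_mul_one_add_log_le {k : ℕ} (hk : k ≠ 0) :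
    ∑ n ∈ Finset.range k, (((n + 1 : ℕ) : ℝ) * (1 + Real.log (n + 1 : ℕ)))⁻¹
      ≤ 1 + Real.log (1 + Real.log k) := by
  induction k, Nat.one_le_iff_ne_zero.2 hk using Nat.le_induction with
  | base => simp
  | succ k hk₁ ih =>
    have hk₁ : (1 : ℝ) ≤ k := mod_cast hk₁
    have hx : 0 < 1 + Real.log k := by linarith [Real.log_nonneg hk₁]
    have hy : 0 < 1 + Real.log (k + 1) := by linarith [Real.log_nonneg (x := k + 1) (by linarith)]
    have hloglog := Real.one_sub_inv_le_log_of_pos (div_pos hy hx)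
    have hlog := Real.one_sub_inv_le_log_of_pos (x := (k + 1) / k) (by positivity)
    rw [Real.log_div hy.ne' hx.ne', inv_div] at hloglog
    rw [Real.log_div (by positivity) (by positivity), inv_div] at hlog
    have hterm : (((k : ℝ) + 1) * (1 + Real.log (k + 1)))⁻¹
        ≤ 1 - (1 + Real.log k) / (1 + Real.log (k + 1)) := by
      rw [mul_inv, one_sub_div hy.ne', div_eq_mul_inv]
      gcongr
      calc ((k : ℝ) + 1)⁻¹ = 1 - k / (k + 1) := by field_simp; ring
        _ ≤ _ := by linarith
    rw [Finset.sum_range_succ]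
    push_cast at ih ⊢
    linarith [ih (by positivity)]

theorem rpow_one_div_rpow_neg {p y : ℝ} (hp : p ≠ 0) (hy : 0 ≤ y) :
    (y ^ (1 / p)) ^ (-p) = y⁻¹ := by
  rw [Real.rpow_neg (Real.rpow_nonneg hy _), one_div, Real.rpow_inv_rpow hy hp]

theorem rpow_one_div_div_self {p y : ℝ} (hp : p ≠ 0) (hy : 0 < y) :
    y ^ (1 / p) / y = 1 / y ^ ((p - 1) / p) := by
  rw [← Real.rpow_sub_one hy.ne', one_div (_ ^ _), ← Real.rpow_neg hy.le]
  congr 1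
  field_simp
  ring

/-- The scale `(k (1 + log k))^{1/p}` of the anytime stepsizes and clipping levels. -/
noncomputable def anytimeScale (p : ℝ) (k : ℕ) : ℝ := ((k : ℝ) * (1 + Real.log k)) ^ (1 / p)

theorem anytimeScale_one (p : ℝ) : anytimeScale p 1 = 1 := by
  simp [anytimeScale]

theorem monotoneOn_anytimeScale {p : ℝ} (hp : 0 ≤ p) :
    MonotoneOn (anytimeScale p) (Set.Ici 1) := by
  intro i hi j _ hij
  have hi₁ : (1 : ℝ) ≤ i := mod_cast hi
  have := Real.log_nonneg hi₁
  unfold anytimeScale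
  gcongr

theorem sum_anytimeScale_rpow_neg_le {p : ℝ} {k : ℕ} (hp : p ≠ 0) (hk : k ≠ 0) :
    ∑ n ∈ Finset.range k, anytimeScale p (n + 1) ^ (-p) ≤ 1 + Real.log (1 + Real.log k) := by
  refine (Finset.sum_congr rfl fun n _ => ?_).trans_le (sum_inv_mul_one_add_log_le hk)
  have := Real.log_natCast_nonneg (n + 1)
  exact rpow_one_div_rpow_neg hp (by positivity)

theorem anytimeScale_div_self {p : ℝ} {k : ℕ} (hp : p ≠ 0) (hk : k ≠ 0) :
    anytimeScale p k / k = (1 + Real.log k) ^ (1 / p) / (k : ℝ) ^ ((p - 1) / p) := by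
  have hk₀ : (0 : ℝ) < k := by positivity
  have := Real.log_natCast_nonneg k
  rw [anytimeScale, Real.mul_rpow hk₀.le (by positivity), mul_comm, mul_div_assoc,
    rpow_one_div_div_self hp hk₀, mul_one_div]

end Scales

end ClippedSsGM

theorem mainTheorem6_general {p σ ε lam R : ℝ} {L : ℝ≥0} (hp₁ : 1 ≤ p) (hp₂ : p ≤ 2) (hσ : 0 ≤ σ)
    (hε : 0 < ε) (hlam : 0 < lam) {H : Type*} [NormedAddCommGroup H] [InnerProductSpace ℝ H]
    [CompleteSpace H] [TopologicalSpace.SeparableSpace H] [MeasurableSpace H] [BorelSpace H]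
    {Ω Ξ : Type*} [MeasurableSpace Ω] [MeasurableSpace Ξ] {P : Measure Ω} [IsProbabilityMeasure P]
    {f : H → ℝ} {X : Set H} {uhat : H → Ξ → H} {ξ : Ω → Ξ} {m : ℕ} {ξs : ℕ → Fin m → Ω → Ξ}
    {x₁ xstar : H} (hf : LipschitzWith L f) (hc : IsClosed X) (hconv : Convex ℝ X)
    (hxs : xstar ∈ X) (hmin : IsMinOn f X xstar)
    (h : ClippedSsGM.IsStochasticSubgradient P f X uhat ξ p σ) (hm : 1 ≤ m)
    (hs : ClippedSsGM.IsSampling P ξ m ξs) (hx₁ : x₁ ∈ X) (hR : ‖x₁ - xstar‖ ≤ R) {δ : ℝ}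
    (hδ : 0 < δ) (hδ₁ : δ ≤ 2 / Real.exp 1) {γ : ℝ} (hγ : γ = 1 / Real.log (2 / δ)) {k : ℕ}
    (hk : 1 ≤ k) :
    (1 - δ ≤ P.real {ω |
      f (ClippedSsGM.average X uhat (ClippedSsGM.stepAT p γ)
          (ClippedSsGM.clipAT p L ε lam) m ξs x₁ k ω) - f xstar
        ≤ ClippedSsGM.radiusConst p σ ε lam R L ^ 2
          * ((1 + Real.log k) ^ (1 / p) / (k : ℝ) ^ ((p - 1) / p)
            * ((1 + Real.log (1 + Real.log k)) ^ 2 + Real.log (2 / δ)))}) ∧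
    (1 - δ ≤ P.real {ω |
      f (ClippedSsGM.average X uhat (ClippedSsGM.stepFH p γ k)
          (ClippedSsGM.clipFH p L ε lam k) m ξs x₁ k ω) - f xstar
        ≤ ClippedSsGM.radiusConst p σ ε lam R L ^ 2
          * (1 / (k : ℝ) ^ ((p - 1) / p) * (1 + Real.log (2 / δ)))}) := by
  have := UniformSpace.secondCountable_of_separable H
  have hp₀ : 0 < p := zero_lt_one.trans_le hp₁
  have hk₀ : k ≠ 0 := Nat.one_le_iff_ne_zero.1 hk
  have hk₁ : (1 : ℝ) ≤ k := mod_cast hk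
  have hT : 1 ≤ Real.log (2 / δ) := by
    rw [Real.le_log_iff_exp_le (by positivity)]
    exact (le_div_comm₀ hδ (Real.exp_pos 1)).1 hδ₁
  have hexp : 1 - δ ≤ 1 - Real.exp (-Real.log (2 / δ)) := by
    rw [Real.exp_neg, Real.exp_log (by positivity), inv_div]
    linarith
  subst hγ
  constructor <;> refine hexp.trans ?_
  · rw [← ClippedSsGM.anytimeScale_div_self hp₀.ne' hk₀]
    exact h.one_sub_exp_le_measureReal_average hs hm hf hc hconv hxs hmin hx₁ hR hp₁ hp₂ hσ hε hlam
      (ClippedSsGM.anytimeScale_one p).ge (ClippedSsGM.monotoneOn_anytimeScale hp₀.le) hT hk₀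
      (ClippedSsGM.sum_anytimeScale_rpow_neg_le hp₀.ne' hk₀)
  · have hsum : ∑ _n ∈ Finset.range k, ((k : ℝ) ^ (1 / p)) ^ (-p) ≤ 1 := by
      rw [Finset.sum_const, Finset.card_range, nsmul_eq_mul,
        ClippedSsGM.rpow_one_div_rpow_neg hp₀.ne' (by positivity), mul_inv_cancel₀ (by positivity)]
    have hrate := h.one_sub_exp_le_measureReal_average (a := fun _ => (k : ℝ) ^ (1 / p)) hs hm hf hc
      hconv hxs hmin hx₁ hR hp₁ hp₂ hσ hε hlam (Real.one_le_rpow hk₁ (by positivity))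
      (monotone_const.monotoneOn _) hT hk₀ hsum
    rwa [ClippedSsGM.rpow_one_div_div_self hp₀.ne' (by positivity), one_pow] at hrate

theorem mainTheorem6 (p σ ε lam R : ℝ) (L : ℝ≥0) (hp₁ : 1 < p) (hp₂ : p ≤ 2) (hσ : 0 ≤ σ)
    (hε : 0 < ε) (hlam : 0 < lam) (hL : 0 < L) :
    ∃ c : ℝ, 0 ≤ c ∧
      ∀ (H : Type*) [NormedAddCommGroup H] [InnerProductSpace ℝ H] [CompleteSpace H]
        [TopologicalSpace.SeparableSpace H] [MeasurableSpace H] [BorelSpace H]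
        (Ω Ξ : Type*) [MeasurableSpace Ω] [MeasurableSpace Ξ]
        (P : Measure Ω) [IsProbabilityMeasure P]
        (f : H → ℝ) (X : Set H) (uhat : H → Ξ → H) (ξ : Ω → Ξ)
        (m : ℕ) (ξs : ℕ → Fin m → Ω → Ξ) (x₁ xstar : H),
        ConvexOn ℝ Set.univ f → LipschitzWith L f →
        IsClosed X → Convex ℝ X →
        xstar ∈ X → IsMinOn f X xstar →
        ClippedSsGM.IsStochasticSubgradient P f X uhat ξ p σ →
        1 ≤ m → ClippedSsGM.IsSampling P ξ m ξs →
        x₁ ∈ X → ‖x₁ - xstar‖ ≤ R →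
        ∀ δ : ℝ, 0 < δ → δ ≤ 2 / Real.exp 1 → ∀ γ : ℝ, γ = 1 / Real.log (2 / δ) →
        ∀ k : ℕ, 1 ≤ k →
          (1 - δ ≤ P.real {ω |
            f (ClippedSsGM.average X uhat (ClippedSsGM.stepAT p γ)
                (ClippedSsGM.clipAT p L ε lam) m ξs x₁ k ω) - f xstar
              ≤ c * ((1 + Real.log k) ^ (1 / p) / (k : ℝ) ^ ((p - 1) / p)
                * ((1 + Real.log (1 + Real.log k)) ^ 2 + Real.log (2 / δ)))}) ∧
          (1 - δ ≤ P.real {ω |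
            f (ClippedSsGM.average X uhat (ClippedSsGM.stepFH p γ k)
                (ClippedSsGM.clipFH p L ε lam k) m ξs x₁ k ω) - f xstar
              ≤ c * (1 / (k : ℝ) ^ ((p - 1) / p) * (1 + Real.log (2 / δ)))}) :=
  ⟨ClippedSsGM.radiusConst p σ ε lam R L ^ 2, sq_nonneg _,
    fun _ _ _ _ _ _ _ _ _ _ _ _ _ _ _ _ _ _ _ _ _ _ hf hc hconv hxs hmin h hm hs hx₁ hR _ hδ hδ₁
      _ hγ _ hk => mainTheorem6_general hp₁.le hp₂ hσ hε hlam hf hc hconv hxs hmin h hm hs hx₁ hR hδ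
        hδ₁ hγ hk⟩
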